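/- Let $\mathcal A,\mathcal B$ be small bicategories (with horizontal composition $\circ$, vertical composition $\cdot$, and right and left unit constraints $r_u:u\circ 1\cong u$ and $l_u:1\circ u\cong u$), and let $F:\mathcal A\to\mathcal B$ be a lax functor with structure 2-cells $\widehat F_{v,u}:Fv\circ Fu\Rightarrow F(v\circ u)$ and $\widehat F_a:1_{Fa}\Rightarrow F1_a$. For an object $b$ of $\mathcal B$, the homotopy fiber $F{\downarrow}_b$ is the bicategory whose objects are pairs $(f,a)$ with $a$ an object of $\mathcal A$ and $f:Fa\to b$ a 1-cell of $\mathcal B$; whose 1-cells $(\beta,u):(f,a)\to(f',a')$ consist of a 1-cell $u:a\to a'$ and a 2-cell $\beta:f\Rightarrow f'\circ Fu$; and whose 2-cells $(\beta,u)\Rightarrow(\beta',u')$ are the 2-cells $\alpha:u\Rightarrow u'$ with $(1_{f'}\circ F\alpha)\cdot\beta=\beta'$. Composites and identities of 1-cells are obtained by pasting, using $\widehat F$. These bicategories form an oplax bidiagram of bicategories $F{\downarrow}:b\mapsto F{\downarrow}_b$ over $\mathcal B$: a 1-cell $p:b\to b'$ induces the homomorphism $p_*:F{\downarrow}_b\to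 F{\downarrow}_{b'}$, $(f,a)\mapsto(p\circ f,a)$, a 2-cell $\sigma:p\Rightarrow p'$ induces the pseudo transformation $\sigma_*:p_*\Rightarrow p'_*$ whose component at $(f,a)$ is the 1-cell over $1_a$ given by $\sigma\circ 1_f$, and the coherence data are the canonical ones, given by the constraints of $\mathcal A$, $\mathcal B$ and $F$. Let $\int_{\mathcal B}F{\downarrow}$ be the Grothendieck construction on this bidiagram. This is a bicategory with - objects the triples $(f,a,b)$ with $f:Fa\to b$; - 1-cells $(\beta,u,p):(f,a,b)\to(f',a',b')$ consisting of a 1-cell $p:b\to b'$ and a 1-cell $(\beta,u):(p\circ f,a)\to(f',a')$ of $F{\downarrow}_{b'}$; - 2-cells $(\alpha,\sigma):(\beta,u,p)\Rightarrow(\beta',u',p')$ consisting of a 2-cell $\sigma:p\Rightarrow p'$ and a 2-cell $\alpha:(\beta,u)\Rightarrow(\beta',u')\circ\sigma_*(f,a)$ of $F{\downarrow}_{b'}$, so that in particular $\alpha:u\Rightarrow u'\circ 1_a$ in $\mathcal A$. The composite of the underlying 1-cells of $\mathcal A$ in $(\beta',u',p')\circ(\beta,u,p)$ is $(u'\circ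 u)\circ 1_a$. There is a strictly unitary homomorphism $$Q:\int_{\mathcal B}F{\downarrow}\to\mathcal A,\qquad Q(f,a,b)=a,\quad Q(\beta,u,p)=u,\quad Q(\alpha,\sigma)=r_{u'}\cdot\alpha,$$ with composition constraint $\widehat Q=r_{u'\circ u}:(u'\circ u)\circ 1_a\cong u'\circ u$. Call the classifying space of a small bicategory $\mathcal C$ the geometric realization $\mathbf B\mathcal C=|\Delta\mathcal C|$ of its geometric nerve, the simplicial set whose $n$-simplices are all lax functors $[n]\to\mathcal C$; a lax functor between bicategories induces a continuous map of classifying spaces by composition. Then the following hold. 1. The map $\mathbf BQ:\mathbf B\!\int_{\mathcal B}F{\downarrow}\to\mathbf B\mathcal A$ is a homotopy equivalence. 2. There are a lax functor $L:\mathcal A\to\int_{\mathcal B}F{\downarrow}$ such that $QL=1_{\mathcal A}$ (an equality of lax functors), and an oplax transformation $\iota:LQ\Rightarrow 1_{\int_{\mathcal B}F{\downarrow}}$, that is, one whose naturality 2-cell at a 1-cell $x:X\to Y$ has the direction $x\circ\iota_X\Rightarrow\iota_Y\circ LQ(x)$. -/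

import Mathlib

open CategoryTheory Bicategory

universe w₁ w₂ w₃ w₄ v₁ v₂ v₃ v₄ u₁ u₂ u₃ u₄ u

section Fiber

variable {A : Type u₁} [Bicategory.{w₁, v₁} A] {B : Type u₂} [Bicategory.{w₂, v₂} B]

/-!
Composition of 1-cells is written in diagrammatic order. Thus Mathlib's `f ≫ g` is `g ∘ f`, its
left unitor `λ_ f : 𝟙 ≫ f ≅ f` is the right unit constraint `f ∘ 1 ≅ f`, and its right unitor
`ρ_ f` is the left unit constraint `1 ∘ f ≅ f`.

A transformation `ε : F ⇒ G` of lax functors with 2-cells `G f ∘ ε a ⇒ ε a' ∘ F f` is called oplax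
here (lax transformations have the opposite direction); it is Mathlib's `Lax.LaxTrans`, whose
2-cells are `app a ≫ G.map f ⟶ F.map f ≫ app a'`.
-/

/-- The homotopy fiber bicategory `F ↓ b` of a lax functor `F : A ⥤ᴸ B` over `b : B`. An object is
a pair `(arr, base)` consisting of an object `base` of `A` and a 1-cell `arr : F base ⟶ b`. -/
structure HoFiber (F : A ⥤ᴸ B) (b : B) where
  base : A
  arr : F.obj base ⟶ b

namespace HoFiber

variable {F : A ⥤ᴸ B} {b : B}

/-- A 1-cell `(β, u)` of `F ↓ b`: a 1-cell `u` of `A` with a 2-cell `β : f ⟶ F u ≫ f'` of `B`. -/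
@[ext]
structure Hom (X Y : HoFiber F b) where
  u : X.base ⟶ Y.base
  β : X.arr ⟶ F.map u ≫ Y.arr

/-- A 2-cell of `F ↓ b`: a 2-cell `α` of `A` compatible with the 2-cells of `B`. -/
@[ext]
structure Hom₂ {X Y : HoFiber F b} (f g : Hom X Y) where
  α : f.u ⟶ g.u
  w : f.β ≫ F.map₂ α ▷ Y.arr = g.β

instance : CategoryStruct (HoFiber F b) where
  Hom X Y := Hom X Y
  id X := ⟨𝟙 X.base, (λ_ X.arr).inv ≫ F.mapId X.base ▷ X.arr⟩
  comp {_ _ Z} f g := ⟨f.u ≫ g.u,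
    f.β ≫ F.map f.u ◁ g.β ≫ (α_ _ _ _).inv ≫ F.mapComp f.u g.u ▷ Z.arr⟩

instance (X Y : HoFiber F b) : Category (X ⟶ Y) where
  Hom f g := Hom₂ f g
  id f := ⟨𝟙 _, by simp⟩
  comp φ ψ := ⟨φ.α ≫ ψ.α, by
    rw [F.map₂_comp, comp_whiskerRight, ← Category.assoc, φ.w, ψ.w]⟩
  id_comp _ := Hom₂.ext (Category.id_comp _)
  comp_id _ := Hom₂.ext (Category.comp_id _)
  assoc _ _ _ := Hom₂.ext (Category.assoc _ _ _)

/-- The 1-cell of `A` underlying a 1-cell of the homotopy fiber. -/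
def fst {X Y : HoFiber F b} (f : X ⟶ Y) : X.base ⟶ Y.base := Hom.u f

/-- The 2-cell of `B` underlying a 1-cell of the homotopy fiber. -/
def cell {X Y : HoFiber F b} (f : X ⟶ Y) : X.arr ⟶ F.map (fst f) ≫ Y.arr := Hom.β f

/-- Constructor of 1-cells. -/
def homMk {X Y : HoFiber F b} (u : X.base ⟶ Y.base) (β : X.arr ⟶ F.map u ≫ Y.arr) : X ⟶ Y :=
  Hom.mk u β

@[simp] lemma fst_homMk {X Y : HoFiber F b} (u : X.base ⟶ Y.base)
    (β : X.arr ⟶ F.map u ≫ Y.arr) : fst (homMk u β) = u := rfl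
@[simp] lemma cell_homMk {X Y : HoFiber F b} (u : X.base ⟶ Y.base)
    (β : X.arr ⟶ F.map u ≫ Y.arr) : cell (homMk u β) = β := rfl
@[simp] lemma fst_id (X : HoFiber F b) : fst (𝟙 X) = 𝟙 X.base := rfl
lemma cell_id (X : HoFiber F b) :
    cell (𝟙 X) = (λ_ X.arr).inv ≫ F.mapId X.base ▷ X.arr := rfl
@[simp] lemma fst_comp {X Y Z : HoFiber F b} (f : X ⟶ Y) (g : Y ⟶ Z) :
    fst (f ≫ g) = fst f ≫ fst g := rfl
lemma cell_comp {X Y Z : HoFiber F b} (f : X ⟶ Y) (g : Y ⟶ Z) :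
    cell (f ≫ g) = cell f ≫ F.map (fst f) ◁ cell g ≫ (α_ _ _ _).inv ≫
      F.mapComp (fst f) (fst g) ▷ Z.arr := rfl

section
variable {X Y : HoFiber F b} {f g h : X ⟶ Y}

/-- The 2-cell of `A` underlying a 2-cell of the homotopy fiber. -/
def two (η : f ⟶ g) : fst f ⟶ fst g := Hom₂.α η

lemma two_w (η : f ⟶ g) : cell f ≫ F.map₂ (two η) ▷ Y.arr = cell g := Hom₂.w η

/-- Constructor of 2-cells. -/
def hom₂Mk (α : fst f ⟶ fst g) (w : cell f ≫ F.map₂ α ▷ Y.arr = cell g) : f ⟶ g :=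
  Hom₂.mk α w

@[simp] lemma two_hom₂Mk (α : fst f ⟶ fst g) (w : cell f ≫ F.map₂ α ▷ Y.arr = cell g) :
    two (hom₂Mk α w) = α := rfl
@[ext] lemma hom₂_ext {φ ψ : f ⟶ g} (e : two φ = two ψ) : φ = ψ := Hom₂.ext e
@[simp] lemma two_id (f : X ⟶ Y) : two (𝟙 f) = 𝟙 (fst f) := rfl
@[simp] lemma two_comp (φ : f ⟶ g) (ψ : g ⟶ h) : two (φ ≫ ψ) = two φ ≫ two ψ := rfl

/-- An invertible 2-cell of `A` satisfying the compatibility condition gives an invertible 2-cell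
of the homotopy fiber. -/
def isoMk (e : fst f ≅ fst g) (w : cell f ≫ F.map₂ e.hom ▷ Y.arr = cell g) : f ≅ g where
  hom := hom₂Mk e.hom w
  inv := hom₂Mk e.inv (by rw [← w]; simp [← comp_whiskerRight, ← F.map₂_comp])
  hom_inv_id := hom₂_ext e.hom_inv_id
  inv_hom_id := hom₂_ext e.inv_hom_id

@[simp] lemma two_isoMk_hom (e : fst f ≅ fst g) (w : cell f ≫ F.map₂ e.hom ▷ Y.arr = cell g) :
    two (isoMk e w).hom = e.hom := rfl
@[simp] lemma two_isoMk_inv (e : fst f ≅ fst g) (w : cell f ≫ F.map₂ e.hom ▷ Y.arr = cell g) :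
    two (isoMk e w).inv = e.inv := rfl
end

/-- The 1-cell `(f, a) ⟶ (g, a)` over `𝟙 a` given by a 2-cell `θ : f ⟶ g` of `B`. -/
def vert {a : A} {f g : F.obj a ⟶ b} (θ : f ⟶ g) : HoFiber.mk a f ⟶ HoFiber.mk a g :=
  homMk (𝟙 a) (θ ≫ (λ_ g).inv ≫ F.mapId a ▷ g)

section
variable {a a' : A} {f g h : F.obj a ⟶ b} {f' g' : F.obj a' ⟶ b}

@[simp] lemma fst_vert (θ : f ⟶ g) : fst (vert (F := F) θ) = 𝟙 a := rfl
lemma cell_vert (θ : f ⟶ g) :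
    cell (vert (F := F) θ) = θ ≫ (λ_ g).inv ≫ F.mapId a ▷ g := rfl

lemma vert_comp_w (θ : f ⟶ g) (k : HoFiber.mk a g ⟶ HoFiber.mk a' f') :
    cell (vert (F := F) θ ≫ k) ≫ F.map₂ (λ_ (fst k)).hom ▷ f' = θ ≫ cell k := by
  simp only [cell_comp, fst_vert, cell_vert, Category.assoc]
  calc
    _ = θ ≫ (𝟙 _ ⊗≫ (F.mapId a ▷ g ≫ F.map (𝟙 a) ◁ cell k) ⊗≫
        (F.mapComp (𝟙 a) (fst k) ≫ F.map₂ (λ_ (fst k)).hom) ▷ f') := by bicategory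
    _ = θ ≫ (𝟙 _ ⊗≫ 𝟙 _ ◁ cell k ⊗≫
        (F.mapId a ▷ F.map (fst k) ≫ F.mapComp (𝟙 a) (fst k) ≫
          F.map₂ (λ_ (fst k)).hom) ▷ f') := by
      rw [← whisker_exchange]; bicategory
    _ = _ := by
      rw [← F.map₂_leftUnitor_hom]; bicategory

lemma comp_vert_w (k : HoFiber.mk a f ⟶ HoFiber.mk a' f') (κ : f' ⟶ g') :
    cell (k ≫ vert (F := F) κ) ≫ F.map₂ (ρ_ (fst k)).hom ▷ g' =
      cell k ≫ F.map (fst k) ◁ κ := by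
  simp only [cell_comp, fst_vert, cell_vert]
  calc
    _ = cell k ≫ F.map (fst k) ◁ κ ≫ (𝟙 _ ⊗≫
        (F.map (fst k) ◁ F.mapId a' ≫ F.mapComp (fst k) (𝟙 a') ≫
          F.map₂ (ρ_ (fst k)).hom) ▷ g') := by bicategory
    _ = _ := by
      rw [← F.map₂_rightUnitor_hom]; bicategory

end

/-- Whiskering and the constraint cells are those of `A`. -/
def wl {X Y Z : HoFiber F b} (f : X ⟶ Y) {g h : Y ⟶ Z} (η : g ⟶ h) : f ≫ g ⟶ f ≫ h :=
  hom₂Mk (fst f ◁ two η) (by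
    change (cell f ≫ F.map (fst f) ◁ cell g ≫ (α_ _ _ _).inv ≫
      F.mapComp (fst f) (fst g) ▷ Z.arr) ≫ F.map₂ (fst f ◁ two η) ▷ Z.arr =
      cell f ≫ F.map (fst f) ◁ cell h ≫ (α_ _ _ _).inv ≫ F.mapComp (fst f) (fst h) ▷ Z.arr
    simp only [← two_w η, Category.assoc, ← comp_whiskerRight, F.mapComp_naturality_right]
    simp)

def wr {X Y Z : HoFiber F b} {f g : X ⟶ Y} (η : f ⟶ g) (h : Y ⟶ Z) : f ≫ h ⟶ g ≫ h :=
  hom₂Mk (two η ▷ fst h) (by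
    simp only [cell_comp, fst_comp, ← two_w η, Category.assoc, ← comp_whiskerRight,
      F.mapComp_naturality_left]
    simp [← whisker_exchange_assoc])

def assocIso {X Y Z W : HoFiber F b} (f : X ⟶ Y) (g : Y ⟶ Z) (h : Z ⟶ W) :
    (f ≫ g) ≫ h ≅ f ≫ (g ≫ h) :=
  isoMk (α_ (fst f) (fst g) (fst h)) (by
    simp only [cell_comp, fst_comp, Category.assoc]
    congr 1
    calc
      _ = 𝟙 _ ⊗≫ F.map (fst f) ◁ cell g ⊗≫
          (F.mapComp (fst f) (fst g) ▷ Z.arr ≫ F.map (fst f ≫ fst g) ◁ cell h) ⊗≫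
          (F.mapComp (fst f ≫ fst g) (fst h) ≫
            F.map₂ (α_ (fst f) (fst g) (fst h)).hom) ▷ W.arr := by bicategory
      _ = 𝟙 _ ⊗≫ F.map (fst f) ◁ cell g ⊗≫
          (F.map (fst f) ≫ F.map (fst g)) ◁ cell h ⊗≫
          (F.mapComp (fst f) (fst g) ▷ F.map (fst h) ≫ F.mapComp (fst f ≫ fst g) (fst h) ≫
            F.map₂ (α_ (fst f) (fst g) (fst h)).hom) ▷ W.arr := by
        rw [← whisker_exchange]; bicategory
      _ = _ := by
        rw [F.map₂_associator]; bicategory)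

def leftIso {X Y : HoFiber F b} (f : X ⟶ Y) : 𝟙 X ≫ f ≅ f :=
  isoMk (λ_ (fst f)) (by
    have := vert_comp_w (F := F) (𝟙 X.arr) f
    rw [Category.id_comp] at this
    rw [← this]
    simp [cell_comp, cell_id, cell_vert])

def rightIso {X Y : HoFiber F b} (f : X ⟶ Y) : f ≫ 𝟙 Y ≅ f :=
  isoMk (ρ_ (fst f)) (by
    have := comp_vert_w (F := F) f (𝟙 Y.arr)
    rw [Bicategory.whiskerLeft_id, Category.comp_id] at this
    rw [← this]
    simp [cell_comp, cell_id, cell_vert])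

section
variable {X Y Z W : HoFiber F b}
@[simp] lemma two_wl (f : X ⟶ Y) {g h : Y ⟶ Z} (η : g ⟶ h) : two (wl f η) = fst f ◁ two η := rfl
@[simp] lemma two_wr {f g : X ⟶ Y} (η : f ⟶ g) (h : Y ⟶ Z) : two (wr η h) = two η ▷ fst h := rfl
@[simp] lemma two_assocIso_hom (f : X ⟶ Y) (g : Y ⟶ Z) (h : Z ⟶ W) :
    two (assocIso f g h).hom = (α_ (fst f) (fst g) (fst h)).hom := rfl
@[simp] lemma two_assocIso_inv (f : X ⟶ Y) (g : Y ⟶ Z) (h : Z ⟶ W) :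
    two (assocIso f g h).inv = (α_ (fst f) (fst g) (fst h)).inv := rfl
@[simp] lemma two_leftIso_hom (f : X ⟶ Y) : two (leftIso f).hom = (λ_ (fst f)).hom := rfl
@[simp] lemma two_leftIso_inv (f : X ⟶ Y) : two (leftIso f).inv = (λ_ (fst f)).inv := rfl
@[simp] lemma two_rightIso_hom (f : X ⟶ Y) : two (rightIso f).hom = (ρ_ (fst f)).hom := rfl
@[simp] lemma two_rightIso_inv (f : X ⟶ Y) : two (rightIso f).inv = (ρ_ (fst f)).inv := rfl
end

instance : Bicategory (HoFiber F b) where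
  whiskerLeft f _ _ η := wl f η
  whiskerRight η h := wr η h
  associator f g h := assocIso f g h
  leftUnitor f := leftIso f
  rightUnitor f := rightIso f
  whiskerLeft_id _ _ := by ext; simp
  whiskerLeft_comp _ _ _ _ _ _ := by ext; simp
  id_whiskerLeft _ := by ext; simp
  comp_whiskerLeft _ _ _ _ _ := by ext; simp
  id_whiskerRight _ _ := by ext; simp
  comp_whiskerRight _ _ _ := by ext; simp
  whiskerRight_id _ := by ext; simp
  whiskerRight_comp _ _ _ := by ext; simp
  whisker_assoc _ _ _ _ _ := by ext; simp
  whisker_exchange _ _ := by ext; simp [whisker_exchange]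
  pentagon _ _ _ _ := by ext; simp
  triangle _ _ := by ext; simp

section
variable {X Y Z W : HoFiber F b}
@[simp] lemma two_whiskerLeft (f : X ⟶ Y) {g h : Y ⟶ Z} (η : g ⟶ h) :
    two (f ◁ η) = fst f ◁ two η := rfl
@[simp] lemma two_whiskerRight {f g : X ⟶ Y} (η : f ⟶ g) (h : Y ⟶ Z) :
    two (η ▷ h) = two η ▷ fst h := rfl
@[simp] lemma two_associator_hom (f : X ⟶ Y) (g : Y ⟶ Z) (h : Z ⟶ W) :
    two (α_ f g h).hom = (α_ (fst f) (fst g) (fst h)).hom := rfl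
@[simp] lemma two_associator_inv (f : X ⟶ Y) (g : Y ⟶ Z) (h : Z ⟶ W) :
    two (α_ f g h).inv = (α_ (fst f) (fst g) (fst h)).inv := rfl
@[simp] lemma two_leftUnitor_hom (f : X ⟶ Y) : two (λ_ f).hom = (λ_ (fst f)).hom := rfl
@[simp] lemma two_leftUnitor_inv (f : X ⟶ Y) : two (λ_ f).inv = (λ_ (fst f)).inv := rfl
@[simp] lemma two_rightUnitor_hom (f : X ⟶ Y) : two (ρ_ f).hom = (ρ_ (fst f)).hom := rfl
@[simp] lemma two_rightUnitor_inv (f : X ⟶ Y) : two (ρ_ f).inv = (ρ_ (fst f)).inv := rfl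
end

/-- The homomorphism `p_* : F ↓ b ⥤ᵖ F ↓ b'` induced by a 1-cell `p : b ⟶ b'` of `B`:
it sends `(f, a)` to `(p ∘ f, a)` and does not change the underlying cells of `A`. -/
def push (F : A ⥤ᴸ B) {b b' : B} (p : b ⟶ b') : HoFiber F b ⥤ᵖ HoFiber F b' where
  obj X := ⟨X.base, X.arr ≫ p⟩
  map {X Y} f := homMk (fst (X := X) (Y := Y) f) (cell f ▷ p ≫ (α_ _ _ _).hom)
  map₂ {X Y f g} η := hom₂Mk (two (f := f) (g := g) η) (by simp [← two_w η])
  mapId X := isoMk (Iso.refl _) (by simp [cell_id])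
  mapComp {X Y Z} f g := isoMk (Iso.refl _) (by simp [cell_comp])
  map₂_id _ := by ext; rfl
  map₂_comp _ _ := by ext; rfl
  map₂_whisker_left f _ _ η := hom₂_ext (show fst f ◁ two η =
    𝟙 (fst f ≫ fst _) ≫ (fst f ◁ two η) ≫ 𝟙 (fst f ≫ fst _) by simp)
  map₂_whisker_right η h := hom₂_ext (show two η ▷ fst h =
    𝟙 (fst _ ≫ fst h) ≫ (two η ▷ fst h) ≫ 𝟙 (fst _ ≫ fst h) by simp)
  map₂_associator f g h := hom₂_ext (show (α_ (fst f) (fst g) (fst h)).hom =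
    𝟙 ((fst f ≫ fst g) ≫ fst h) ≫ 𝟙 (fst f ≫ fst g) ▷ fst h ≫
      (α_ (fst f) (fst g) (fst h)).hom ≫ fst f ◁ 𝟙 (fst g ≫ fst h) ≫
      𝟙 (fst f ≫ fst g ≫ fst h) by simp)
  map₂_left_unitor {X _} f := hom₂_ext (show (λ_ (fst f)).hom =
    𝟙 (𝟙 X.base ≫ fst f) ≫ 𝟙 (𝟙 X.base) ▷ fst f ≫ (λ_ (fst f)).hom by simp)
  map₂_right_unitor {_ Y} f := hom₂_ext (show (ρ_ (fst f)).hom =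
    𝟙 (fst f ≫ 𝟙 Y.base) ≫ fst f ◁ 𝟙 (𝟙 Y.base) ≫ (ρ_ (fst f)).hom by simp)

section
variable {b' : B} (p : b ⟶ b') {X Y Z : HoFiber F b}
@[simp] lemma push_obj : (push F p).obj X = ⟨X.base, X.arr ≫ p⟩ := rfl
@[simp] lemma fst_push_map (f : X ⟶ Y) : fst ((push F p).map f) = fst f := rfl
lemma cell_push_map (f : X ⟶ Y) :
    cell ((push F p).map f) = cell f ▷ p ≫ (α_ _ _ _).hom := rfl
@[simp] lemma two_push_map₂ {f g : X ⟶ Y} (η : f ⟶ g) :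
    two ((push F p).map₂ η) = two η := rfl
@[simp] lemma two_push_mapId_hom : two ((push F p).mapId X).hom = 𝟙 (𝟙 X.base) := rfl
@[simp] lemma two_push_mapId_inv : two ((push F p).mapId X).inv = 𝟙 (𝟙 X.base) := rfl
@[simp] lemma two_push_mapComp_hom (f : X ⟶ Y) (g : Y ⟶ Z) :
    two ((push F p).mapComp f g).hom = 𝟙 (fst f ≫ fst g) := rfl
@[simp] lemma two_push_mapComp_inv (f : X ⟶ Y) (g : Y ⟶ Z) :
    two ((push F p).mapComp f g).inv = 𝟙 (fst f ≫ fst g) := rfl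
end

section
variable {a a' : A} {f g h : F.obj a ⟶ b} {f' g' : F.obj a' ⟶ b}

lemma shift_w {u v w : a ⟶ a'} {x : f ⟶ F.map u ≫ g'} {y : f ⟶ F.map w ≫ g'}
    {m : u ⟶ v} {l : w ≅ v} (e : x ≫ F.map₂ m ▷ g' = y ≫ F.map₂ l.hom ▷ g') :
    x ≫ F.map₂ (m ≫ l.inv) ▷ g' = y := by
  rw [F.map₂_comp, comp_whiskerRight, ← Category.assoc, e, Category.assoc, ← comp_whiskerRight,
    ← F.map₂_comp]
  simp

/-- Vertical 1-cells are natural, up to the canonical 2-cell `u ≫ 𝟙 ≅ 𝟙 ≫ u` of `A`. -/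
def vertNat (u : a ⟶ a') (β : f ⟶ F.map u ≫ f') (γ : g ⟶ F.map u ≫ g')
    (θ : f ⟶ g) (κ : f' ⟶ g') (e : β ≫ F.map u ◁ κ = θ ≫ γ) :
    (homMk u β : HoFiber.mk a f ⟶ HoFiber.mk a' f') ≫ vert (F := F) κ ≅
      vert θ ≫ (homMk u γ : HoFiber.mk a g ⟶ HoFiber.mk a' g') :=
  isoMk (ρ_ u ≪≫ (λ_ u).symm) (shift_w (l := λ_ u)
    ((comp_vert_w (F := F) (homMk u β : HoFiber.mk a f ⟶ HoFiber.mk a' f') κ).trans (e.trans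
      (vert_comp_w (F := F) θ (homMk u γ : HoFiber.mk a g ⟶ HoFiber.mk a' g')).symm)))

/-- Composites of vertical 1-cells are vertical, up to the canonical 2-cell `𝟙 ≫ 𝟙 ≅ 𝟙`. -/
def vertComp (θ : f ⟶ g) (κ : g ⟶ h) (μ : f ⟶ h) (e : θ ≫ κ = μ) :
    vert (F := F) θ ≫ vert κ ≅ vert μ :=
  isoMk (λ_ (𝟙 a)) (by
    refine (vert_comp_w (F := F) θ (vert κ)).trans ?_
    simp [cell_vert, ← e])

def vertId (θ : f ⟶ f) (e : θ = 𝟙 f) : 𝟙 (HoFiber.mk (F := F) a f) ≅ vert θ :=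
  isoMk (Iso.refl _) (by simp [cell_vert, cell_id, e])

def pushVert {b' : B} (p : b ⟶ b') (θ : f ⟶ g) (κ : f ≫ p ⟶ g ≫ p) (e : θ ▷ p = κ) :
    (push F p).map (vert (F := F) θ) ≅ vert κ :=
  isoMk (Iso.refl _) (by
    change ((θ ≫ (λ_ g).inv ≫ F.mapId a ▷ g) ▷ p ≫ (α_ _ _ _).hom) ≫
      F.map₂ (𝟙 (𝟙 a)) ▷ (g ≫ p) = κ ≫ (λ_ (g ≫ p)).inv ≫ F.mapId a ▷ (g ≫ p)
    simp [← e])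

end

section
variable {b' b'' : B}

lemma nat_nat_aux {a a' : A} {u v : a ⟶ a'} (η : u ⟶ v) :
    η ▷ 𝟙 a' ≫ (ρ_ v).hom ≫ (λ_ v).inv = ((ρ_ u).hom ≫ (λ_ u).inv) ≫ 𝟙 a ◁ η := by
  simp

lemma nat_id_aux (a : A) :
    ((ρ_ (𝟙 a)).hom ≫ (λ_ (𝟙 a)).inv) ≫ 𝟙 a ◁ 𝟙 (𝟙 a) =
      𝟙 (𝟙 a) ▷ 𝟙 a ≫ (λ_ (𝟙 a)).hom ≫ (ρ_ (𝟙 a)).inv := by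
  simp [unitors_equal, unitors_inv_equal]

lemma nat_comp_aux {a a' a'' : A} (u : a ⟶ a') (v : a' ⟶ a'') :
    ((ρ_ (u ≫ v)).hom ≫ (λ_ (u ≫ v)).inv) ≫ 𝟙 a ◁ 𝟙 (u ≫ v) =
      𝟙 (u ≫ v) ▷ 𝟙 a'' ≫ (α_ _ _ _).hom ≫ u ◁ ((ρ_ v).hom ≫ (λ_ v).inv) ≫
        (α_ _ _ _).inv ≫ ((ρ_ u).hom ≫ (λ_ u).inv) ▷ v ≫ (α_ _ _ _).hom := by
  simp

/-- The pseudo transformation `σ_* : p_* ⟶ q_*` induced by a 2-cell `σ : p ⟶ q` of `B`. -/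
def pushTwo (F : A ⥤ᴸ B) {p q : b ⟶ b'} (σ : p ⟶ q) :
    Pseudofunctor.StrongTrans (push F p) (push F q) where
  app X := vert (X.arr ◁ σ)
  naturality {X Y} f := vertNat (fst f) (cell f ▷ p ≫ (α_ _ _ _).hom)
    (cell f ▷ q ≫ (α_ _ _ _).hom) (X.arr ◁ σ) (Y.arr ◁ σ) (by
      rw [Category.assoc, ← Category.assoc (X.arr ◁ σ), whisker_exchange]; simp)
  naturality_naturality η := hom₂_ext (nat_nat_aux (two η))
  naturality_id X := hom₂_ext (nat_id_aux X.base)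
  naturality_comp f g := hom₂_ext (nat_comp_aux (fst f) (fst g))

/-- The pseudo transformation `(q ∘ p)_* ⟶ q_* p_*` given by the associator of `B`. -/
def chi (F : A ⥤ᴸ B) (p : b ⟶ b') (q : b' ⟶ b'') :
    Pseudofunctor.StrongTrans (push F (p ≫ q)) ((push F p).comp (push F q)) where
  app X := vert (α_ X.arr p q).inv
  naturality {X Y} f := vertNat (fst f) (cell f ▷ (p ≫ q) ≫ (α_ _ _ _).hom)
    ((cell f ▷ p ≫ (α_ _ _ _).hom) ▷ q ≫ (α_ _ _ _).hom) _ _ (by simp)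
  naturality_naturality η := hom₂_ext (nat_nat_aux (two η))
  naturality_id X := hom₂_ext (by
    refine Eq.trans ?_ (nat_id_aux X.base)
    exact congrArg (fun t => _ ≫ 𝟙 X.base ◁ t) (Category.id_comp (𝟙 (𝟙 X.base))))
  naturality_comp {X _ _} f g := hom₂_ext (by
    refine Eq.trans ?_ (nat_comp_aux (fst f) (fst g))
    exact congrArg (fun t => _ ≫ 𝟙 X.base ◁ t) (Category.id_comp (𝟙 (fst f ≫ fst g))))

/-- The pseudo transformation `(1_b)_* ⟶ 1` given by the unit constraint of `B`. -/
def chiId (F : A ⥤ᴸ B) (b : B) :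
    Pseudofunctor.StrongTrans (push F (𝟙 b)) (Pseudofunctor.id (HoFiber F b)) where
  app X := vert (ρ_ X.arr).hom
  naturality {X Y} f := vertNat (fst f) (cell f ▷ (𝟙 b) ≫ (α_ _ _ _).hom) (cell f) _ _ (by simp)
  naturality_naturality η := hom₂_ext (nat_nat_aux (two η))
  naturality_id X := hom₂_ext (nat_id_aux X.base)
  naturality_comp f g := hom₂_ext (nat_comp_aux (fst f) (fst g))
end

/- The remaining structure of the oplax bidiagram `b ↦ F ↓ b` consists of invertible modifications.
Their components at an object `X` are the following canonical invertible 2-cells between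
composites of vertical 1-cells; the underlying cells of `A` are built from unit constraints. -/
section
variable {b₀ b₁ b₂ b₃ : B}

/-- `σ_* ≫ τ_* ≅ (σ ≫ τ)_*` at `X`. -/
def xiComp (X : HoFiber F b₀) {p q r : b₀ ⟶ b₁} (σ : p ⟶ q) (τ : q ⟶ r) :
    (pushTwo F σ).app X ≫ (pushTwo F τ).app X ≅ (pushTwo F (σ ≫ τ)).app X :=
  vertComp _ _ _ (by simp)

/-- `𝟙 ≅ (𝟙 p)_*` at `X`. -/
def xiId (X : HoFiber F b₀) (p : b₀ ⟶ b₁) :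
    𝟙 ((push F p).obj X) ≅ (pushTwo F (𝟙 p)).app X :=
  vertId _ (by simp)

/-- Naturality of `chi` with respect to 2-cells of `B`, in the first variable. -/
def chiRight (X : HoFiber F b₀) {p p' : b₀ ⟶ b₁} (σ : p ⟶ p') (q : b₁ ⟶ b₂) :
    (pushTwo F (σ ▷ q)).app X ≫ (chi F p' q).app X ≅
      (chi F p q).app X ≫ (push F q).map ((pushTwo F σ).app X) :=
  vertComp _ _ (X.arr ◁ (σ ▷ q) ≫ (α_ X.arr p' q).inv) rfl ≪≫
    (vertComp (α_ X.arr p q).inv ((X.arr ◁ σ) ▷ q) _ (by simp)).symm ≪≫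
    whiskerLeftIso ((chi F p q).app X) (pushVert q (X.arr ◁ σ) _ rfl).symm

/-- Naturality of `chi` with respect to 2-cells of `B`, in the second variable. -/
def chiLeft (X : HoFiber F b₀) (p : b₀ ⟶ b₁) {q q' : b₁ ⟶ b₂} (τ : q ⟶ q') :
    (pushTwo F (p ◁ τ)).app X ≫ (chi F p q').app X ≅
      (chi F p q).app X ≫ (pushTwo F τ).app ((push F p).obj X) :=
  vertComp _ _ (X.arr ◁ (p ◁ τ) ≫ (α_ X.arr p q').inv) rfl ≪≫
    (vertComp (α_ X.arr p q).inv ((X.arr ≫ p) ◁ τ) _ (by simp)).symm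

/-- The associativity constraint of the oplax bidiagram, at `X`. -/
def omega (X : HoFiber F b₀) (p : b₀ ⟶ b₁) (q : b₁ ⟶ b₂) (r : b₂ ⟶ b₃) :
    (chi F (p ≫ q) r).app X ≫ (push F r).map ((chi F p q).app X) ≅
      (pushTwo F (α_ p q r).hom).app X ≫
        ((chi F p (q ≫ r)).app X ≫ (chi F q r).app ((push F p).obj X)) :=
  whiskerLeftIso ((chi F (p ≫ q) r).app X) (pushVert r (α_ X.arr p q).inv _ rfl) ≪≫
    vertComp _ _ ((α_ X.arr (p ≫ q) r).inv ≫ (α_ X.arr p q).inv ▷ r) rfl ≪≫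
    (vertComp (X.arr ◁ (α_ p q r).hom) _ _ (by simp)).symm ≪≫
    whiskerLeftIso ((pushTwo F (α_ p q r).hom).app X)
      (vertComp (α_ X.arr p (q ≫ r)).inv (α_ (X.arr ≫ p) q r).inv _ rfl).symm

/-- The constraint of the oplax bidiagram for the composites `p ≫ 𝟙`, at `X`. -/
def gamma (X : HoFiber F b₀) (p : b₀ ⟶ b₁) :
    (chi F p (𝟙 b₁)).app X ≫ (chiId F b₁).app ((push F p).obj X) ≅
      (pushTwo F (ρ_ p).hom).app X :=
  vertComp (α_ X.arr p (𝟙 b₁)).inv (ρ_ (X.arr ≫ p)).hom _ (by simp)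

/-- The constraint of the oplax bidiagram for the composites `𝟙 ≫ p`, at `X`. -/
def delta (X : HoFiber F b₀) (p : b₀ ⟶ b₁) :
    (chi F (𝟙 b₀) p).app X ≫ (push F p).map ((chiId F b₀).app X) ≅
      (pushTwo F (λ_ p).hom).app X :=
  whiskerLeftIso ((chi F (𝟙 b₀) p).app X) (pushVert p (ρ_ X.arr).hom _ rfl) ≪≫
    vertComp (α_ X.arr (𝟙 b₀) p).inv ((ρ_ X.arr).hom ▷ p) _ (by simp)

end

end HoFiber
end Fiber

section Total

variable {A : Type u₁} [Bicategory.{w₁, v₁} A] {B : Type u₂} [Bicategory.{w₂, v₂} B]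

/-- The bicategory `∫_B F ↓`, the Grothendieck construction on the oplax bidiagram of homotopy
fibers `b ↦ F ↓ b`. An object is an object `b = base` of `B` together with an object
`pt = (f, a)` of `F ↓ b`. -/
structure HoFiberTotal (F : A ⥤ᴸ B) where
  base : B
  pt : HoFiber F base

namespace HoFiberTotal
open HoFiber

variable {F : A ⥤ᴸ B}

/-- A 1-cell is a 1-cell `p : b ⟶ b'` of `B` together with a 1-cell `w : p_* (f, a) ⟶ (f', a')`
of `F ↓ b'`. -/
structure Hom (X Y : HoFiberTotal F) where
  p : X.base ⟶ Y.base
  w : (push F p).obj X.pt ⟶ Y.pt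

/-- A 2-cell is a 2-cell `σ : p ⟶ p'` of `B` together with a 2-cell `φ : w ⟶ w' ∘ σ_* (f, a)`
of `F ↓ b'`. -/
structure Hom₂ {X Y : HoFiberTotal F} (f g : Hom X Y) where
  σ : f.p ⟶ g.p
  φ : f.w ⟶ (pushTwo F σ).app X.pt ≫ g.w

instance : CategoryStruct (HoFiberTotal F) where
  Hom X Y := Hom X Y
  id X := ⟨𝟙 X.base, (chiId F X.base).app X.pt⟩
  comp {X _ _} f g := ⟨f.p ≫ g.p, (chi F f.p g.p).app X.pt ≫ (push F g.p).map f.w ≫ g.w⟩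

/-- The 1-cell of `B` underlying a 1-cell. -/
def dir {X Y : HoFiberTotal F} (f : X ⟶ Y) : X.base ⟶ Y.base := Hom.p f

/-- The 1-cell of the homotopy fiber over the target underlying a 1-cell. -/
def fib {X Y : HoFiberTotal F} (f : X ⟶ Y) : (push F (dir f)).obj X.pt ⟶ Y.pt := Hom.w f

/-- The 1-cell of `A` underlying a 1-cell. -/
def low {X Y : HoFiberTotal F} (f : X ⟶ Y) : X.pt.base ⟶ Y.pt.base := fst (fib f)

instance (X Y : HoFiberTotal F) : Quiver (X ⟶ Y) where
  Hom f g := Hom₂ f g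

section
variable {X Y : HoFiberTotal F} {f g h : X ⟶ Y}

/-- The 2-cell of `B` underlying a 2-cell. -/
def dir₂ (η : f ⟶ g) : dir f ⟶ dir g := Hom₂.σ η

/-- The 2-cell of the homotopy fiber underlying a 2-cell. -/
def fib₂ (η : f ⟶ g) : fib f ⟶ (pushTwo F (dir₂ η)).app X.pt ≫ fib g := Hom₂.φ η

/-- Constructor of 2-cells. -/
def mk₂ (σ : dir f ⟶ dir g) (φ : fib f ⟶ (pushTwo F σ).app X.pt ≫ fib g) : f ⟶ g :=
  Hom₂.mk σ φ

/-- The 2-cell `α : u ⟶ u' ∘ 1` of `A` underlying a 2-cell `(α, σ)`. -/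
def low₂ (η : f ⟶ g) : low f ⟶ 𝟙 X.pt.base ≫ low g := two (fib₂ η)

/-- The 2-cell `u ⟶ u'` of `A` obtained from `α : u ⟶ u' ∘ 1` and the unit constraint. -/
def bar (η : f ⟶ g) : low f ⟶ low g := low₂ η ≫ (λ_ (low g)).hom

lemma low₂_eq (η : f ⟶ g) : low₂ η = bar η ≫ (λ_ (low g)).inv := by
  simp [bar]

lemma hom₂_ext {η θ : f ⟶ g} (h₁ : dir₂ η = dir₂ θ) (h₂ : bar η = bar θ) : η = θ := by
  obtain ⟨σ, φ⟩ := η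
  obtain ⟨τ, ψ⟩ := θ
  obtain rfl : σ = τ := h₁
  congr 1
  apply HoFiber.hom₂_ext
  exact (cancel_mono (λ_ (low _)).hom).1 h₂

end

instance (X Y : HoFiberTotal F) : CategoryStruct (X ⟶ Y) where
  id f := mk₂ (𝟙 (dir f)) ((λ_ (fib f)).inv ≫ (xiId X.pt (dir f)).hom ▷ fib f)
  comp {_ _ h} η θ := mk₂ (dir₂ η ≫ dir₂ θ)
    (fib₂ η ≫ (pushTwo F (dir₂ η)).app X.pt ◁ fib₂ θ ≫ (α_ _ _ _).inv ≫
      (xiComp X.pt (dir₂ η) (dir₂ θ)).hom ▷ fib h)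

section
variable {X Y : HoFiberTotal F} {f g h : X ⟶ Y}

lemma dir₂_id (f : X ⟶ Y) : dir₂ (𝟙 f) = 𝟙 (dir f) := rfl
lemma dir₂_comp (η : f ⟶ g) (θ : g ⟶ h) : dir₂ (η ≫ θ) = dir₂ η ≫ dir₂ θ := rfl
lemma bar_id (f : X ⟶ Y) : bar (𝟙 f) = 𝟙 (low f) := by
  change ((λ_ (low f)).inv ≫ 𝟙 (𝟙 _) ▷ low f) ≫ (λ_ (low f)).hom = 𝟙 (low f)
  simp
lemma bar_comp (η : f ⟶ g) (θ : g ⟶ h) : bar (η ≫ θ) = bar η ≫ bar θ := by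
  change (low₂ η ≫ 𝟙 _ ◁ low₂ θ ≫ (α_ (𝟙 X.pt.base) (𝟙 X.pt.base) (low h)).inv ≫
    (λ_ (𝟙 X.pt.base)).hom ▷ low h) ≫ (λ_ (low h)).hom = bar η ≫ bar θ
  simp [low₂_eq]

end

instance (X Y : HoFiberTotal F) : Category (X ⟶ Y) where
  id_comp η := hom₂_ext (Category.id_comp _) (by rw [bar_comp, bar_id]; exact Category.id_comp _)
  comp_id η := hom₂_ext (Category.comp_id _) (by rw [bar_comp, bar_id]; exact Category.comp_id _)
  assoc _ _ _ := hom₂_ext (Category.assoc _ _ _) (by simp only [bar_comp, Category.assoc])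

section
variable {a a₁ a₂ a₃ a₄ : A}

lemma inv_aux (u v : a ⟶ a₁) (t : 𝟙 a ≫ v ⟶ u) :
    ((λ_ v).inv ≫ 𝟙 (𝟙 a) ▷ v ≫ (λ_ (𝟙 a)).inv ▷ v ≫ (α_ (𝟙 a) (𝟙 a) v).hom ≫
      𝟙 a ◁ t) ≫ (λ_ u).hom = (λ_ v).inv ≫ t := by
  simp

lemma hom_inv_aux {u v : a ⟶ a₁} {s : u ⟶ 𝟙 a ≫ v} {t : 𝟙 a ≫ v ⟶ u} (h : s ≫ t = 𝟙 u) :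
    (s ≫ (λ_ v).hom) ≫ (λ_ v).inv ≫ t = 𝟙 u := by
  simpa using h

lemma inv_hom_aux {u v : a ⟶ a₁} {s : u ⟶ 𝟙 a ≫ v} {t : 𝟙 a ≫ v ⟶ u}
    (h : t ≫ s = 𝟙 (𝟙 a ≫ v)) : ((λ_ v).inv ≫ t) ≫ s ≫ (λ_ v).hom = 𝟙 v := by
  rw [Category.assoc, reassoc_of% h]; simp

/-- The canonical 2-cell of `A` underlying the associators. -/
def lowAssoc (u : a₁ ⟶ a₂) (v : a₂ ⟶ a₃) (w : a₃ ⟶ a₄) :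
    𝟙 a₁ ≫ ((𝟙 a₁ ≫ (u ≫ v)) ≫ w) ≅ 𝟙 a₁ ≫ (u ≫ (𝟙 a₂ ≫ (v ≫ w))) :=
  whiskerLeftIso (𝟙 a₁) (whiskerRightIso (λ_ (u ≫ v)) w ≪≫ α_ u v w ≪≫
    whiskerLeftIso u (λ_ (v ≫ w)).symm)

/-- The canonical 2-cell of `A` underlying the left unitors. -/
def lowLeft (u : a₁ ⟶ a₂) : 𝟙 a₁ ≫ (𝟙 a₁ ≫ u) ≅ u := λ_ (𝟙 a₁ ≫ u) ≪≫ λ_ u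

/-- The canonical 2-cell of `A` underlying the right unitors. -/
def lowRight (u : a₁ ⟶ a₂) : 𝟙 a₁ ≫ (u ≫ 𝟙 a₂) ≅ u := λ_ (u ≫ 𝟙 a₂) ≪≫ ρ_ u

end

section
variable {X Y Z W : HoFiberTotal F}

/-- The inverse of a 2-cell whose two components are invertible. -/
def invMk {f g : X ⟶ Y} (σ : dir f ≅ dir g)
    (φ : fib f ≅ (pushTwo F σ.hom).app X.pt ≫ fib g) : g ⟶ f :=
  mk₂ σ.inv ((λ_ (fib g)).inv ≫
    (vertId (X.pt.arr ◁ (σ.inv ≫ σ.hom)) (by simp)).hom ▷ fib g ≫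
    (xiComp X.pt σ.inv σ.hom).inv ▷ fib g ≫ (α_ _ _ _).hom ≫
    (pushTwo F σ.inv).app X.pt ◁ φ.inv)

lemma bar_mk₂ {f g : X ⟶ Y} (σ : dir f ⟶ dir g)
    (φ : fib f ⟶ (pushTwo F σ).app X.pt ≫ fib g) :
    bar (mk₂ σ φ) = (two φ : low f ⟶ 𝟙 X.pt.base ≫ low g) ≫ (λ_ (low g)).hom := rfl

lemma bar_invMk {f g : X ⟶ Y} (σ : dir f ≅ dir g)
    (φ : fib f ≅ (pushTwo F σ.hom).app X.pt ≫ fib g) :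
    bar (invMk σ φ) = (λ_ (low g)).inv ≫ (two φ.inv : 𝟙 X.pt.base ≫ low g ⟶ low f) :=
  inv_aux (low f) (low g) (two φ.inv)

/-- A 2-cell whose two components are invertible is invertible. -/
def isoMk {f g : X ⟶ Y} (σ : dir f ≅ dir g)
    (φ : fib f ≅ (pushTwo F σ.hom).app X.pt ≫ fib g) : f ≅ g where
  hom := mk₂ σ.hom φ.hom
  inv := invMk σ φ
  hom_inv_id := hom₂_ext σ.hom_inv_id (by
    rw [bar_comp, bar_id, bar_invMk, bar_mk₂]
    exact hom_inv_aux (congrArg two φ.hom_inv_id))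
  inv_hom_id := hom₂_ext σ.inv_hom_id (by
    rw [bar_comp, bar_id, bar_invMk, bar_mk₂]
    exact inv_hom_aux (congrArg two φ.inv_hom_id))

/-- Whiskering of a 2-cell by a 1-cell on the source side. -/
def wl (f : X ⟶ Y) {g h : Y ⟶ Z} (η : g ⟶ h) : f ≫ g ⟶ f ≫ h :=
  mk₂ (dir f ◁ dir₂ η)
    ((chi F (dir f) (dir g)).app X.pt ◁ (push F (dir g)).map (fib f) ◁ fib₂ η ≫
      (chi F (dir f) (dir g)).app X.pt ◁ (α_ _ _ _).inv ≫
      (chi F (dir f) (dir g)).app X.pt ◁ ((pushTwo F (dir₂ η)).naturality (fib f)).hom ▷ fib h ≫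
      (chi F (dir f) (dir g)).app X.pt ◁ (α_ _ _ _).hom ≫
      (α_ _ _ _).inv ≫
      (chiLeft X.pt (dir f) (dir₂ η)).inv ▷ ((push F (dir h)).map (fib f) ≫ fib h) ≫
      (α_ _ _ _).hom)

/-- Whiskering of a 2-cell by a 1-cell on the target side. -/
def wr {f g : X ⟶ Y} (η : f ⟶ g) (h : Y ⟶ Z) : f ≫ h ⟶ g ≫ h :=
  mk₂ (dir₂ η ▷ dir h)
    ((chi F (dir f) (dir h)).app X.pt ◁ ((push F (dir h)).map₂ (fib₂ η) ▷ fib h) ≫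
      (chi F (dir f) (dir h)).app X.pt ◁
        (((push F (dir h)).mapComp ((pushTwo F (dir₂ η)).app X.pt) (fib g)).hom ▷ fib h) ≫
      (chi F (dir f) (dir h)).app X.pt ◁ (α_ _ _ _).hom ≫
      (α_ _ _ _).inv ≫
      (chiRight X.pt (dir₂ η) (dir h)).inv ▷ ((push F (dir h)).map (fib g) ≫ fib h) ≫
      (α_ _ _ _).hom)

/-- The associator: over that of `B`, it is pasted from the associativity constraint of the
bidiagram and the naturality of `chi`. -/
def assocIso (f : X ⟶ Y) (g : Y ⟶ Z) (h : Z ⟶ W) : (f ≫ g) ≫ h ≅ f ≫ (g ≫ h) :=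
  isoMk (α_ (dir f) (dir g) (dir h))
    (whiskerLeftIso ((chi F (dir f ≫ dir g) (dir h)).app X.pt)
        (whiskerRightIso
          ((push F (dir h)).mapComp ((chi F (dir f) (dir g)).app X.pt)
              ((push F (dir g)).map (fib f) ≫ fib g) ≪≫
            whiskerLeftIso ((push F (dir h)).map ((chi F (dir f) (dir g)).app X.pt))
              ((push F (dir h)).mapComp ((push F (dir g)).map (fib f)) (fib g))) (fib h) ≪≫
          α_ _ _ _) ≪≫
      (α_ _ _ _).symm ≪≫
      whiskerRightIso (omega X.pt (dir f) (dir g) (dir h)) _ ≪≫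
      α_ _ _ _ ≪≫
      whiskerLeftIso ((pushTwo F (α_ (dir f) (dir g) (dir h)).hom).app X.pt)
        (α_ _ _ _ ≪≫
          whiskerLeftIso ((chi F (dir f) (dir g ≫ dir h)).app X.pt)
            (whiskerLeftIso ((chi F (dir g) (dir h)).app ((push F (dir f)).obj X.pt))
                (α_ _ _ _) ≪≫
              (α_ _ _ _).symm ≪≫
              whiskerRightIso ((chi F (dir g) (dir h)).naturality (fib f)).symm _ ≪≫
              α_ _ _ _)))

/-- The unitor of `𝟙 ≫ f`, over that of `B`. -/
def leftIso (f : X ⟶ Y) : 𝟙 X ≫ f ≅ f :=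
  isoMk (λ_ (dir f))
    ((α_ _ _ _).symm ≪≫ whiskerRightIso (delta X.pt (dir f)) (fib f))

/-- The unitor of `f ≫ 𝟙`, over that of `B`. -/
def rightIso (f : X ⟶ Y) : f ≫ 𝟙 Y ≅ f :=
  isoMk (ρ_ (dir f))
    (whiskerLeftIso ((chi F (dir f) (𝟙 Y.base)).app X.pt)
        ((chiId F Y.base).naturality (fib f)) ≪≫
      (α_ _ _ _).symm ≪≫ whiskerRightIso (gamma X.pt (dir f)) (fib f))

lemma dir_comp (f : X ⟶ Y) (g : Y ⟶ Z) : dir (f ≫ g) = dir f ≫ dir g := rfl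
lemma low_comp (f : X ⟶ Y) (g : Y ⟶ Z) : low (f ≫ g) = 𝟙 X.pt.base ≫ (low f ≫ low g) := rfl

lemma bar_wl (f : X ⟶ Y) {g h : Y ⟶ Z} (η : g ⟶ h) :
    bar (wl f η) = 𝟙 X.pt.base ◁ (low f ◁ bar η) := by
  change (𝟙 X.pt.base ◁ low f ◁ low₂ η ≫
    𝟙 X.pt.base ◁ (α_ (low f) (𝟙 Y.pt.base) (low h)).inv ≫
    𝟙 X.pt.base ◁ ((ρ_ (low f)).hom ≫ (λ_ (low f)).inv) ▷ low h ≫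
    𝟙 X.pt.base ◁ (α_ (𝟙 X.pt.base) (low f) (low h)).hom ≫
    (α_ (𝟙 X.pt.base) (𝟙 X.pt.base) (low f ≫ low h)).inv ≫
    ((λ_ (𝟙 X.pt.base)).hom ≫ (λ_ (𝟙 X.pt.base)).inv) ▷ (low f ≫ low h) ≫
    (α_ (𝟙 X.pt.base) (𝟙 X.pt.base) (low f ≫ low h)).hom) ≫
    (λ_ (𝟙 X.pt.base ≫ low f ≫ low h)).hom = _
  rw [low₂_eq]
  bicategory

lemma bar_wr {f g : X ⟶ Y} (η : f ⟶ g) (h : Y ⟶ Z) :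
    bar (wr η h) = 𝟙 X.pt.base ◁ (bar η ▷ low h) := by
  change (𝟙 X.pt.base ◁ (low₂ η ▷ low h) ≫
    𝟙 X.pt.base ◁ (𝟙 (𝟙 X.pt.base ≫ low g) ▷ low h) ≫
    𝟙 X.pt.base ◁ (α_ (𝟙 X.pt.base) (low g) (low h)).hom ≫
    (α_ (𝟙 X.pt.base) (𝟙 X.pt.base) (low g ≫ low h)).inv ≫
    ((𝟙 X.pt.base ◁ 𝟙 (𝟙 X.pt.base) ≫ (λ_ (𝟙 X.pt.base)).hom) ≫
      (λ_ (𝟙 X.pt.base)).inv) ▷ (low g ≫ low h) ≫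
    (α_ (𝟙 X.pt.base) (𝟙 X.pt.base) (low g ≫ low h)).hom) ≫
    (λ_ (𝟙 X.pt.base ≫ low g ≫ low h)).hom = _
  rw [low₂_eq]
  bicategory

lemma bar_assocIso_hom (f : X ⟶ Y) (g : Y ⟶ Z) (h : Z ⟶ W) :
    bar (assocIso f g h).hom =
      (lowAssoc (low f) (low g) (low h)).hom := by
  change (𝟙 X.pt.base ◁
      ((𝟙 (𝟙 X.pt.base ≫ (low f ≫ low g)) ≫ 𝟙 X.pt.base ◁ 𝟙 (low f ≫ low g)) ▷ low h ≫
        (α_ (𝟙 X.pt.base) (low f ≫ low g) (low h)).hom) ≫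
    (α_ (𝟙 X.pt.base) (𝟙 X.pt.base) ((low f ≫ low g) ≫ low h)).inv ≫
    (𝟙 X.pt.base ◁ 𝟙 (𝟙 X.pt.base) ≫ (λ_ (𝟙 X.pt.base)).hom ≫ (λ_ (𝟙 X.pt.base)).inv ≫
      𝟙 X.pt.base ◁ (λ_ (𝟙 X.pt.base)).inv) ▷ ((low f ≫ low g) ≫ low h) ≫
    (α_ (𝟙 X.pt.base) (𝟙 X.pt.base ≫ 𝟙 X.pt.base) ((low f ≫ low g) ≫ low h)).hom ≫
    𝟙 X.pt.base ◁ ((α_ (𝟙 X.pt.base) (𝟙 X.pt.base) ((low f ≫ low g) ≫ low h)).hom ≫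
      𝟙 X.pt.base ◁ (𝟙 X.pt.base ◁ (α_ (low f) (low g) (low h)).hom ≫
        (α_ (𝟙 X.pt.base) (low f) (low g ≫ low h)).inv ≫
        ((λ_ (low f)).hom ≫ (ρ_ (low f)).inv) ▷ (low g ≫ low h) ≫
        (α_ (low f) (𝟙 Y.pt.base) (low g ≫ low h)).hom))) ≫
    (λ_ (𝟙 X.pt.base ≫ low f ≫ 𝟙 Y.pt.base ≫ low g ≫ low h)).hom =
      𝟙 X.pt.base ◁ ((λ_ (low f ≫ low g)).hom ▷ low h ≫ (α_ (low f) (low g) (low h)).hom ≫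
        low f ◁ (λ_ (low g ≫ low h)).inv)
  bicategory

lemma bar_leftIso_hom (f : X ⟶ Y) :
    bar (leftIso f).hom = (lowLeft (low f)).hom := by
  change ((α_ (𝟙 X.pt.base) (𝟙 X.pt.base) (low f)).inv ≫
    (𝟙 X.pt.base ◁ 𝟙 (𝟙 X.pt.base) ≫ (λ_ (𝟙 X.pt.base)).hom) ▷ low f) ≫ (λ_ (low f)).hom =
      (λ_ (𝟙 X.pt.base ≫ low f)).hom ≫ (λ_ (low f)).hom
  bicategory

lemma bar_rightIso_hom (f : X ⟶ Y) :
    bar (rightIso f).hom = (lowRight (low f)).hom := by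
  change (𝟙 X.pt.base ◁ ((ρ_ (low f)).hom ≫ (λ_ (low f)).inv) ≫
    (α_ (𝟙 X.pt.base) (𝟙 X.pt.base) (low f)).inv ≫
    (λ_ (𝟙 X.pt.base)).hom ▷ low f) ≫ (λ_ (low f)).hom =
      (λ_ (low f ≫ 𝟙 Y.pt.base)).hom ≫ (ρ_ (low f)).hom
  bicategory

lemma bar_inv {f g : X ⟶ Y} (e : f ≅ g) (t : low f ≅ low g) (h : bar e.hom = t.hom) :
    bar e.inv = t.inv := by
  have h₁ : bar e.hom ≫ bar e.inv = 𝟙 (low f) := by rw [← bar_comp, e.hom_inv_id, bar_id]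
  rw [h] at h₁
  exact (Iso.inv_comp_eq_id t.symm).1 (by simpa using h₁) |>.symm ▸ rfl

lemma bar_assocIso_inv (f : X ⟶ Y) (g : Y ⟶ Z) (h : Z ⟶ W) :
    bar (assocIso f g h).inv = (lowAssoc (low f) (low g) (low h)).inv :=
  bar_inv _ _ (bar_assocIso_hom f g h)
lemma bar_leftIso_inv (f : X ⟶ Y) : bar (leftIso f).inv = (lowLeft (low f)).inv :=
  bar_inv _ _ (bar_leftIso_hom f)
lemma bar_rightIso_inv (f : X ⟶ Y) : bar (rightIso f).inv = (lowRight (low f)).inv :=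
  bar_inv _ _ (bar_rightIso_hom f)

end

section
variable {a a₁ a₂ a₃ a₄ : A}

lemma ax_whiskerLeft_comp (u : a ⟶ a₁) {v w x : a₁ ⟶ a₂} (s : v ⟶ w) (t : w ⟶ x) :
    𝟙 a ◁ (u ◁ (s ≫ t)) = 𝟙 a ◁ (u ◁ s) ≫ 𝟙 a ◁ (u ◁ t) := by simp

lemma ax_id_whiskerLeft {v w : a ⟶ a₁} (s : v ⟶ w) :
    𝟙 a ◁ (𝟙 a ◁ s) = (lowLeft v).hom ≫ s ≫ (lowLeft w).inv := by
  simp [lowLeft]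

lemma ax_comp_whiskerLeft (u : a ⟶ a₁) (v : a₁ ⟶ a₂) {w x : a₂ ⟶ a₃} (s : w ⟶ x) :
    𝟙 a ◁ ((𝟙 a ≫ (u ≫ v)) ◁ s) =
      (lowAssoc u v w).hom ≫ 𝟙 a ◁ (u ◁ (𝟙 a₁ ◁ (v ◁ s))) ≫ (lowAssoc u v x).inv := by
  simp [lowAssoc]

lemma ax_comp_whiskerRight {u v w : a ⟶ a₁} (s : u ⟶ v) (t : v ⟶ w) (x : a₁ ⟶ a₂) :
    𝟙 a ◁ ((s ≫ t) ▷ x) = 𝟙 a ◁ (s ▷ x) ≫ 𝟙 a ◁ (t ▷ x) := by simp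

lemma ax_whiskerRight_id {u v : a ⟶ a₁} (s : u ⟶ v) :
    𝟙 a ◁ (s ▷ 𝟙 a₁) = (lowRight u).hom ≫ s ≫ (lowRight v).inv := by
  simp only [lowRight, Iso.trans_hom, Iso.trans_inv]
  bicategory

lemma ax_whiskerRight_comp {u v : a ⟶ a₁} (s : u ⟶ v) (w : a₁ ⟶ a₂) (x : a₂ ⟶ a₃) :
    𝟙 a ◁ (s ▷ (𝟙 a₁ ≫ (w ≫ x))) =
      (lowAssoc u w x).inv ≫ 𝟙 a ◁ ((𝟙 a ◁ (s ▷ w)) ▷ x) ≫ (lowAssoc v w x).hom := by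
  simp only [lowAssoc, Iso.trans_inv, Iso.trans_hom, whiskerLeftIso_hom, whiskerLeftIso_inv,
    whiskerRightIso_hom, whiskerRightIso_inv, Iso.symm_inv, Iso.symm_hom]
  rw [← cancel_epi (𝟙 a ◁ u ◁ (λ_ (w ≫ x)).inv), ← cancel_mono (𝟙 a ◁ v ◁ (λ_ (w ≫ x)).hom)]
  simp

lemma ax_whisker_assoc (u : a ⟶ a₁) {v w : a₁ ⟶ a₂} (s : v ⟶ w) (x : a₂ ⟶ a₃) :
    𝟙 a ◁ ((𝟙 a ◁ (u ◁ s)) ▷ x) =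
      (lowAssoc u v x).hom ≫ 𝟙 a ◁ (u ◁ (𝟙 a₁ ◁ (s ▷ x))) ≫ (lowAssoc u w x).inv := by
  simp [lowAssoc]

lemma ax_whisker_exchange {u v : a ⟶ a₁} {w x : a₁ ⟶ a₂} (s : u ⟶ v) (t : w ⟶ x) :
    𝟙 a ◁ (u ◁ t) ≫ 𝟙 a ◁ (s ▷ x) = 𝟙 a ◁ (s ▷ w) ≫ 𝟙 a ◁ (v ◁ t) := by
  rw [← Bicategory.whiskerLeft_comp, ← Bicategory.whiskerLeft_comp, whisker_exchange]

lemma ax_pentagon (u : a ⟶ a₁) (v : a₁ ⟶ a₂) (w : a₂ ⟶ a₃) (x : a₃ ⟶ a₄) :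
    𝟙 a ◁ ((lowAssoc u v w).hom ▷ x) ≫ (lowAssoc u (𝟙 a₁ ≫ (v ≫ w)) x).hom ≫
      𝟙 a ◁ (u ◁ (lowAssoc v w x).hom) =
    (lowAssoc (𝟙 a ≫ (u ≫ v)) w x).hom ≫ (lowAssoc u v (𝟙 a₂ ≫ (w ≫ x))).hom := by
  simp only [lowAssoc, Iso.trans_hom, whiskerLeftIso_hom, whiskerRightIso_hom, Iso.symm_hom]
  bicategory

lemma ax_triangle (u : a ⟶ a₁) (v : a₁ ⟶ a₂) :
    (lowAssoc u (𝟙 a₁) v).hom ≫ 𝟙 a ◁ (u ◁ (lowLeft v).hom) =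
      𝟙 a ◁ ((lowRight u).hom ▷ v) := by
  simp only [lowAssoc, lowLeft, lowRight, Iso.trans_hom, whiskerLeftIso_hom, whiskerRightIso_hom,
    Iso.symm_hom]
  bicategory

end

section
variable {X Y Z W V : HoFiberTotal F}

lemma wl_id (f : X ⟶ Y) (g : Y ⟶ Z) : wl f (𝟙 g) = 𝟙 (f ≫ g) :=
  hom₂_ext (Bicategory.whiskerLeft_id (dir f) (dir g)) (by
    rw [bar_wl, bar_id, bar_id]
    exact (congrArg _ (Bicategory.whiskerLeft_id (low f) (low g))).trans
      (Bicategory.whiskerLeft_id _ _))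

lemma wl_comp (f : X ⟶ Y) {g h i : Y ⟶ Z} (η : g ⟶ h) (θ : h ⟶ i) :
    wl f (η ≫ θ) = wl f η ≫ wl f θ :=
  hom₂_ext (Bicategory.whiskerLeft_comp (dir f) (dir₂ η) (dir₂ θ)) (by
    simp only [bar_comp, bar_wl]
    exact ax_whiskerLeft_comp (low f) (bar η) (bar θ))

lemma id_wl {f g : X ⟶ Y} (η : f ⟶ g) :
    wl (𝟙 X) η = (leftIso f).hom ≫ η ≫ (leftIso g).inv :=
  hom₂_ext (Bicategory.id_whiskerLeft (dir₂ η)) (by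
    simp only [bar_comp, bar_wl, bar_leftIso_hom, bar_leftIso_inv]
    exact ax_id_whiskerLeft (bar η))

lemma comp_wl (f : X ⟶ Y) (g : Y ⟶ Z) {h i : Z ⟶ W} (η : h ⟶ i) :
    wl (f ≫ g) η = (assocIso f g h).hom ≫ wl f (wl g η) ≫ (assocIso f g i).inv :=
  hom₂_ext (Bicategory.comp_whiskerLeft (dir f) (dir g) (dir₂ η)) (by
    simp only [bar_comp, bar_wl, bar_assocIso_hom, bar_assocIso_inv]
    exact ax_comp_whiskerLeft (low f) (low g) (bar η))

lemma id_wr (f : X ⟶ Y) (g : Y ⟶ Z) : wr (𝟙 f) g = 𝟙 (f ≫ g) :=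
  hom₂_ext (Bicategory.id_whiskerRight (dir f) (dir g)) (by
    rw [bar_wr, bar_id, bar_id]
    exact (congrArg _ (Bicategory.id_whiskerRight (low f) (low g))).trans
      (Bicategory.whiskerLeft_id _ _))

lemma comp_wr {f g h : X ⟶ Y} (η : f ⟶ g) (θ : g ⟶ h) (i : Y ⟶ Z) :
    wr (η ≫ θ) i = wr η i ≫ wr θ i :=
  hom₂_ext (Bicategory.comp_whiskerRight (dir₂ η) (dir₂ θ) (dir i)) (by
    simp only [bar_comp, bar_wr]
    exact ax_comp_whiskerRight (bar η) (bar θ) (low i))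

lemma wr_id {f g : X ⟶ Y} (η : f ⟶ g) :
    wr η (𝟙 Y) = (rightIso f).hom ≫ η ≫ (rightIso g).inv :=
  hom₂_ext (Bicategory.whiskerRight_id (dir₂ η)) (by
    simp only [bar_comp, bar_wr, bar_rightIso_hom, bar_rightIso_inv]
    exact ax_whiskerRight_id (bar η))

lemma wr_comp {f g : X ⟶ Y} (η : f ⟶ g) (h : Y ⟶ Z) (i : Z ⟶ W) :
    wr η (h ≫ i) = (assocIso f h i).inv ≫ wr (wr η h) i ≫ (assocIso g h i).hom :=
  hom₂_ext (Bicategory.whiskerRight_comp (dir₂ η) (dir h) (dir i)) (by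
    simp only [bar_comp, bar_wr, bar_assocIso_hom, bar_assocIso_inv]
    exact ax_whiskerRight_comp (bar η) (low h) (low i))

lemma wl_wr (f : X ⟶ Y) {g h : Y ⟶ Z} (η : g ⟶ h) (i : Z ⟶ W) :
    wr (wl f η) i = (assocIso f g i).hom ≫ wl f (wr η i) ≫ (assocIso f h i).inv :=
  hom₂_ext (Bicategory.whisker_assoc (dir f) (dir₂ η) (dir i)) (by
    simp only [bar_comp, bar_wl, bar_wr, bar_assocIso_hom, bar_assocIso_inv]
    exact ax_whisker_assoc (low f) (bar η) (low i))

lemma wl_exchange {f g : X ⟶ Y} {h i : Y ⟶ Z} (η : f ⟶ g) (θ : h ⟶ i) :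
    wl f θ ≫ wr η i = wr η h ≫ wl g θ :=
  hom₂_ext (Bicategory.whisker_exchange (dir₂ η) (dir₂ θ)) (by
    simp only [bar_comp, bar_wl, bar_wr]
    exact ax_whisker_exchange (bar η) (bar θ))

lemma assoc_pentagon (f : X ⟶ Y) (g : Y ⟶ Z) (h : Z ⟶ W) (i : W ⟶ V) :
    wr (assocIso f g h).hom i ≫ (assocIso f (g ≫ h) i).hom ≫ wl f (assocIso g h i).hom =
      (assocIso (f ≫ g) h i).hom ≫ (assocIso f g (h ≫ i)).hom :=
  hom₂_ext (Bicategory.pentagon (dir f) (dir g) (dir h) (dir i)) (by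
    simp only [bar_comp, bar_wl, bar_wr, bar_assocIso_hom]
    exact ax_pentagon (low f) (low g) (low h) (low i))

lemma assoc_triangle (f : X ⟶ Y) (g : Y ⟶ Z) :
    (assocIso f (𝟙 Y) g).hom ≫ wl f (leftIso g).hom = wr (rightIso f).hom g :=
  hom₂_ext (Bicategory.triangle (dir f) (dir g)) (by
    simp only [bar_comp, bar_wl, bar_wr, bar_assocIso_hom, bar_leftIso_hom, bar_rightIso_hom]
    exact ax_triangle (low f) (low g))

end

instance : Bicategory (HoFiberTotal F) where
  whiskerLeft f _ _ η := wl f η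
  whiskerRight η h := wr η h
  associator f g h := assocIso f g h
  leftUnitor f := leftIso f
  rightUnitor f := rightIso f
  whiskerLeft_id f g := wl_id f g
  whiskerLeft_comp f _ _ _ η θ := wl_comp f η θ
  id_whiskerLeft η := id_wl η
  comp_whiskerLeft f g _ _ η := comp_wl f g η
  id_whiskerRight f g := id_wr f g
  comp_whiskerRight η θ h := comp_wr η θ h
  whiskerRight_id η := wr_id η
  whiskerRight_comp η g h := wr_comp η g h
  whisker_assoc f _ _ η h := wl_wr f η h
  whisker_exchange η θ := wl_exchange η θ
  pentagon f g h i := assoc_pentagon f g h i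
  triangle f g := assoc_triangle f g
section
variable {a a₁ a₂ a₃ a₄ : A}
lemma ax_assoc (u : a ⟶ a₁) (v : a₁ ⟶ a₂) (w : a₂ ⟶ a₃) :
    (lowAssoc u v w).hom = (λ_ ((𝟙 a ≫ u ≫ v) ≫ w)).hom ≫ (λ_ (u ≫ v)).hom ▷ w ≫
      (α_ u v w).hom ≫ u ◁ (λ_ (v ≫ w)).inv ≫ (λ_ (u ≫ 𝟙 a₁ ≫ v ≫ w)).inv := by
  simp [lowAssoc]
lemma ax_left (u : a ⟶ a₁) : (lowLeft u).hom =
    (λ_ (𝟙 a ≫ u)).hom ≫ 𝟙 (𝟙 a) ▷ u ≫ (λ_ u).hom := by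
  simp [lowLeft]
lemma ax_right (u : a ⟶ a₁) : (lowRight u).hom =
    (λ_ (u ≫ 𝟙 a₁)).hom ≫ u ◁ 𝟙 (𝟙 a₁) ≫ (ρ_ u).hom := by
  simp [lowRight]
end

/-- The projection homomorphism `Q : ∫_B F ↓ ⥤ᵖ A`. It sends `(f, a, b)` to `a`, a 1-cell
`(β, u, p)` to `u`, and a 2-cell `(α, σ)` to the composite of `α : u ⟶ u' ∘ 1` with the unit
constraint `u' ∘ 1 ≅ u'`. It is strictly unitary, and its composition constraint is the
unit constraint `(u' ∘ u) ∘ 1 ≅ u' ∘ u`. -/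
def proj (F : A ⥤ᴸ B) : HoFiberTotal F ⥤ᵖ A where
  obj X := X.pt.base
  map f := low f
  map₂ η := bar η
  mapId X := Iso.refl (𝟙 X.pt.base)
  mapComp f g := λ_ (low f ≫ low g)
  map₂_id f := bar_id f
  map₂_comp η θ := bar_comp η θ
  map₂_whisker_left f _ _ η := (bar_wl f η).trans (Bicategory.id_whiskerLeft (low f ◁ bar η))
  map₂_whisker_right η h := (bar_wr η h).trans (Bicategory.id_whiskerLeft (bar η ▷ low h))
  map₂_associator f g h := (bar_assocIso_hom f g h).trans (ax_assoc (low f) (low g) (low h))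
  map₂_left_unitor f := (bar_leftIso_hom f).trans (ax_left (low f))
  map₂_right_unitor f := (bar_rightIso_hom f).trans (ax_right (low f))

end HoFiberTotal
end Total

section Nerve

/-- A criterion for equality of lax functors. -/
lemma lax_eq_of {B : Type u₁} [Bicategory.{w₁, v₁} B] {C : Type u₂} [Bicategory.{w₂, v₂} C]
    {F G : B ⥤ᴸ C} (h : F.toPrelaxFunctor = G.toPrelaxFunctor)
    (h₁ : ∀ b, HEq (F.mapId b) (G.mapId b))
    (h₂ : ∀ {a b c} (f : a ⟶ b) (g : b ⟶ c), HEq (F.mapComp f g) (G.mapComp f g)) : F = G := by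
  obtain ⟨F, i, c⟩ := F
  obtain ⟨G, i', c'⟩ := G
  obtain rfl : F = G := h
  obtain rfl : i = i' := funext fun b => eq_of_heq (h₁ b)
  obtain rfl : @c = @c' := by
    funext _ _ _ f g
    exact eq_of_heq (h₂ f g)
  rfl

lemma lax_comp_assoc {B : Type u₁} [Bicategory.{w₁, v₁} B] {C : Type u₂} [Bicategory.{w₂, v₂} C]
    {D : Type u₃} [Bicategory.{w₃, v₃} D] {E : Type u₄} [Bicategory.{w₄, v₄} E]
    (F : B ⥤ᴸ C) (G : C ⥤ᴸ D) (H : D ⥤ᴸ E) : (F.comp G).comp H = F.comp (G.comp H) :=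
  lax_eq_of rfl
    (fun b => heq_of_eq (show H.mapId _ ≫ H.map₂ (G.mapId _ ≫ G.map₂ (F.mapId b)) =
      (H.mapId _ ≫ H.map₂ (G.mapId _)) ≫ H.map₂ (G.map₂ (F.mapId b)) by
        rw [H.map₂_comp, Category.assoc]))
    (fun f g => heq_of_eq (show H.mapComp _ _ ≫ H.map₂ (G.mapComp _ _ ≫ G.map₂ (F.mapComp f g)) =
      (H.mapComp _ _ ≫ H.map₂ (G.mapComp _ _)) ≫ H.map₂ (G.map₂ (F.mapComp f g)) by
        rw [H.map₂_comp, Category.assoc]))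

/-- The ordered set `[n] = {0 < 1 < ⋯ < n}`, as a bicategory in which all 2-cells are identities. -/
abbrev OrdBicat (n : ℕ) : Type := LocallyDiscrete (Fin (n + 1))

/-- A nondecreasing map `[m] → [n]`, as a (strict) lax functor. -/
def ordMap {m n : ℕ} (σ : Fin (m + 1) →o Fin (n + 1)) : OrdBicat m ⥤ᴸ OrdBicat n where
  obj i := ⟨σ i.as⟩
  map f := ⟨homOfLE (σ.monotone (leOfHom f.as))⟩
  map₂ η := eqToHom (by rw [LocallyDiscrete.eq_of_hom η])
  mapId _ := 𝟙 _
  mapComp _ _ := 𝟙 _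
  map₂_id _ := rfl
  map₂_comp _ _ := rfl
  mapComp_naturality_left _ _ := rfl
  mapComp_naturality_right _ _ _ _ := rfl
  map₂_associator _ _ _ := rfl
  map₂_leftUnitor _ := rfl
  map₂_rightUnitor _ := rfl

lemma ordMap_id_comp {n : ℕ} {B : Type u} [Bicategory.{u, u} B] (z : OrdBicat n ⥤ᴸ B) :
    (ordMap OrderHom.id).comp z = z :=
  lax_eq_of rfl
    (fun b => heq_of_eq (show z.mapId b ≫ z.map₂ (𝟙 _) = z.mapId b by
      rw [z.map₂_id, Category.comp_id]))
    (fun f g => heq_of_eq (show z.mapComp f g ≫ z.map₂ (𝟙 _) = z.mapComp f g by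
      rw [z.map₂_id, Category.comp_id]))

/-- The (non-unitary) geometric nerve: an `n`-simplex is a lax functor `[n] ⥤ᴸ B`, and a map
`σ : [m] → [n]` acts by composition of lax functors. -/
def geometricNerve (B : Type u) [Bicategory.{u, u} B] : SSet.{u} where
  obj n := OrdBicat n.unop.len ⥤ᴸ B
  map σ := ↾ fun z => (ordMap σ.unop.toOrderHom).comp z
  map_id n := by
    ext z
    exact ordMap_id_comp z
  map_comp σ τ := by
    ext z
    exact lax_comp_assoc (ordMap τ.unop.toOrderHom) (ordMap σ.unop.toOrderHom) z

/-- The map of geometric nerves induced by a lax functor: composition with `G`. -/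
def geometricNerveMap {B C : Type u} [Bicategory.{u, u} B] [Bicategory.{u, u} C] (G : B ⥤ᴸ C) :
    geometricNerve B ⟶ geometricNerve C where
  app n := ↾ fun z => z.comp G
  naturality _ _ σ := by
    ext z
    exact lax_comp_assoc (ordMap σ.unop.toOrderHom) z G

/-- The classifying space of a small bicategory. -/
noncomputable def classifyingSpace (B : Type u) [Bicategory.{u, u} B] : TopCat.{u} := SSet.toTop.obj (geometricNerve B)

/-- The continuous map on classifying spaces induced by a lax functor. -/
noncomputable def classifyingMap {B C : Type u} [Bicategory.{u, u} B] [Bicategory.{u, u} C] (G : B ⥤ᴸ C) :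
    C(classifyingSpace B, classifyingSpace C) := (SSet.toTop.map (geometricNerveMap G)).hom
end Nerve

/-! The projection `Q` has a lax section `L = sec F`, sending `a` to `(1, a, F a)` and a 1-cell `u`
to `F u` lying over `u`. The universal arrow into `(f, a, b)` is `f` itself, seen as a 1-cell `(1,
a, F a) ⟶ (f, a, b)` over the identity of `a`. These 1-cells form the oplax transformation `ι =
counit F`: at a 1-cell `(β, u, p)` the 2-cell of `B` that expresses its naturality is `β`. Since `QL
= 1` strictly (`sec_comp_proj`), half of the homotopy equivalence is an equality, and the other half
follows once a transformation of lax functors is known to induce a homotopy of classifying spaces.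

A 2-cell of the total bicategory amounts to a compatible pair of a 2-cell `dir₂` of `B` and a 2-cell
`bar` of `A` (`cellMk`, `side_w`, `hom₂_ext`). So each law for `L` or `ι` splits in two. In `B` it
is a law of `F`, or the formula for the 2-cell of an identity or of a composite (`side_comp`), or
the compatibility of a given 2-cell; in `A` it is coherence or naturality of constraints.

A transformation `F ⇒ G` is the same as a suitable lax functor on `C × {false < true}`
(`laxCylinder`); the oplax direction is what allows the component to be moved to the end of a
composite. Pairing a simplex of the nerve with a monotone map to `{false < true}` gives a simplicial
homotopy (`nerveHomotopy`).

To realize it, `Δⁿ × [0,1]` is cut into `n + 1` prisms by the levels `tail t k`. The maps on the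
prisms glue (`exists_glue`) and are natural in the simplex (`prismMap_map`), so they define a
simplicial map from `X` to the singular complex of the space of paths in the realization of `Y`. Its
adjoint is a path-valued map on the realization of `X`, that is, the homotopy (`homotopic_toTop`).
-/

open Opposite

/-! ### The cylinder of a transformation, as a lax functor on `C × {false < true}`. -/

section Cylinder

variable {C : Type u₁} [Bicategory.{w₁, v₁} C] {D : Type u₂} [Bicategory.{w₂, v₂} D]
  {F G : C ⥤ᴸ D} (η : Lax.LaxTrans F G)

namespace LaxCylinder

/-- The ordered set `{false < true}`, as a locally discrete bicategory. -/
abbrev Two : Type := LocallyDiscrete Bool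

/-- The values of the cylinder of a transformation on objects. -/
def obj (_ : Lax.LaxTrans F G) : C × Two → D
  | (a, ⟨false⟩) => F.obj a
  | (a, ⟨true⟩) => G.obj a

/-- The values of the cylinder of a transformation on 1-cells. -/
def map : {x y : C × Two} → (x ⟶ y) → (obj η x ⟶ obj η y)
  | (_, ⟨false⟩), (_, ⟨false⟩), f => F.map f.1
  | (_, ⟨false⟩), (b, ⟨true⟩), f => F.map f.1 ≫ η.app b
  | (_, ⟨true⟩), (_, ⟨true⟩), f => G.map f.1
  | (_, ⟨true⟩), (_, ⟨false⟩), f => absurd (leOfHom f.2.as) (by simp)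

/-- The values of the cylinder of a transformation on 2-cells. -/
def map₂ : {x y : C × Two} → {f g : x ⟶ y} → (f ⟶ g) → (map η f ⟶ map η g)
  | (_, ⟨false⟩), (_, ⟨false⟩), _, _, θ => F.map₂ θ.1
  | (_, ⟨false⟩), (b, ⟨true⟩), _, _, θ => F.map₂ θ.1 ▷ η.app b
  | (_, ⟨true⟩), (_, ⟨true⟩), _, _, θ => G.map₂ θ.1
  | (_, ⟨true⟩), (_, ⟨false⟩), f, _, _ => absurd (leOfHom f.2.as) (by simp)

/-- The unit constraint of the cylinder of a transformation. -/
def mapId : (x : C × Two) → (𝟙 (obj η x) ⟶ map η (𝟙 x))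
  | (a, ⟨false⟩) => F.mapId a
  | (a, ⟨true⟩) => G.mapId a

/-- The composition constraint of the cylinder of a transformation. -/
def mapComp : {x y z : C × Two} → (f : x ⟶ y) → (g : y ⟶ z) →
    (map η f ≫ map η g ⟶ map η (f ≫ g))
  | (_, ⟨false⟩), (_, ⟨false⟩), (_, ⟨false⟩), f, g => F.mapComp f.1 g.1
  | (_, ⟨false⟩), (_, ⟨false⟩), (c, ⟨true⟩), f, g =>
    (α_ _ _ _).inv ≫ F.mapComp f.1 g.1 ▷ η.app c
  | (_, ⟨false⟩), (_, ⟨true⟩), (c, ⟨true⟩), f, g =>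
    (α_ _ _ _).hom ≫ F.map f.1 ◁ η.naturality g.1 ≫ (α_ _ _ _).inv ≫
      F.mapComp f.1 g.1 ▷ η.app c
  | (_, ⟨true⟩), (_, ⟨true⟩), (_, ⟨true⟩), f, g => G.mapComp f.1 g.1
  | (_, ⟨true⟩), (_, ⟨false⟩), _, f, _ => absurd (leOfHom f.2.as) (by simp)
  | (_, ⟨_⟩), (_, ⟨true⟩), (_, ⟨false⟩), _, g => absurd (leOfHom g.2.as) (by simp)

section
variable {a b c d : C}

/-- The 2-cell `s` and the naturality cell at `g` act on different factors, so they commute by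
interchange. -/
lemma naturality_left_aux {f f' : a ⟶ b} (s : f ⟶ f') (g : b ⟶ c) :
    ((α_ _ _ _).hom ≫ F.map f ◁ η.naturality g ≫ (α_ _ _ _).inv ≫
        F.mapComp f g ▷ η.app c) ≫ F.map₂ (s ▷ g) ▷ η.app c =
      (F.map₂ s ▷ η.app b) ▷ G.map g ≫ (α_ _ _ _).hom ≫ F.map f' ◁ η.naturality g ≫
        (α_ _ _ _).inv ≫ F.mapComp f' g ▷ η.app c :=
  calc
    _ = 𝟙 _ ⊗≫ F.map f ◁ η.naturality g ⊗≫
        (F.mapComp f g ≫ F.map₂ (s ▷ g)) ▷ η.app c := by bicategory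
    _ = 𝟙 _ ⊗≫ (F.map f ◁ η.naturality g ≫ F.map₂ s ▷ (F.map g ≫ η.app c)) ⊗≫
        F.mapComp f' g ▷ η.app c := by rw [F.mapComp_naturality_left]; bicategory
    _ = _ := by rw [whisker_exchange]; bicategory

/-- Here `s` starts in the `G` end and must cross the naturality cell, which is
`naturality_naturality`. -/
lemma naturality_right_aux (f : a ⟶ b) {g g' : b ⟶ c} (s : g ⟶ g') :
    ((α_ _ _ _).hom ≫ F.map f ◁ η.naturality g ≫ (α_ _ _ _).inv ≫
        F.mapComp f g ▷ η.app c) ≫ F.map₂ (f ◁ s) ▷ η.app c =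
      (F.map f ≫ η.app b) ◁ G.map₂ s ≫ (α_ _ _ _).hom ≫ F.map f ◁ η.naturality g' ≫
        (α_ _ _ _).inv ≫ F.mapComp f g' ▷ η.app c :=
  calc
    _ = 𝟙 _ ⊗≫ F.map f ◁ η.naturality g ⊗≫
        (F.mapComp f g ≫ F.map₂ (f ◁ s)) ▷ η.app c := by bicategory
    _ = 𝟙 _ ⊗≫ F.map f ◁ (η.naturality g ≫ F.map₂ s ▷ η.app c) ⊗≫
        F.mapComp f g' ▷ η.app c := by rw [F.mapComp_naturality_right]; bicategory
    _ = _ := by rw [η.naturality_naturality]; bicategory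

/-- The passage from `F` to `G` occurs in the last 1-cell: this is the associativity law of `F`
whiskered by the component `t`. -/
lemma associator_aux₁ (f : a ⟶ b) (g : b ⟶ c) (h : c ⟶ d) {x : D} (t : F.obj d ⟶ x) :
    F.mapComp f g ▷ (F.map h ≫ t) ≫ ((α_ _ _ _).inv ≫ F.mapComp (f ≫ g) h ▷ t) ≫
        F.map₂ (α_ f g h).hom ▷ t =
      (α_ _ _ _).hom ≫ F.map f ◁ ((α_ _ _ _).inv ≫ F.mapComp g h ▷ t) ≫ (α_ _ _ _).inv ≫
        F.mapComp f (g ≫ h) ▷ t :=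
  calc
    _ = 𝟙 _ ⊗≫ (F.mapComp f g ▷ F.map h ≫ F.mapComp (f ≫ g) h ≫ F.map₂ (α_ f g h).hom) ▷ t := by
      bicategory
    _ = _ := by rw [F.map₂_associator]; bicategory

/-- The passage occurs in `g`. The only naturality cell is the one at `h`; interchange carries it
past `F.mapComp f g`, and the associativity law of `F` remains. -/
lemma associator_aux₂ (f : a ⟶ b) (g : b ⟶ c) (h : c ⟶ d) :
    ((α_ _ _ _).inv ≫ F.mapComp f g ▷ η.app c) ▷ G.map h ≫
        ((α_ _ _ _).hom ≫ F.map (f ≫ g) ◁ η.naturality h ≫ (α_ _ _ _).inv ≫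
          F.mapComp (f ≫ g) h ▷ η.app d) ≫ F.map₂ (α_ f g h).hom ▷ η.app d =
      (α_ _ _ _).hom ≫ F.map f ◁ ((α_ _ _ _).hom ≫ F.map g ◁ η.naturality h ≫
        (α_ _ _ _).inv ≫ F.mapComp g h ▷ η.app d) ≫ (α_ _ _ _).inv ≫
        F.mapComp f (g ≫ h) ▷ η.app d :=
  calc
    _ = 𝟙 _ ⊗≫ (F.mapComp f g ▷ (η.app c ≫ G.map h) ≫ F.map (f ≫ g) ◁ η.naturality h) ⊗≫
        (F.mapComp (f ≫ g) h ≫ F.map₂ (α_ f g h).hom) ▷ η.app d := by bicategory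
    _ = 𝟙 _ ⊗≫ (F.map f ≫ F.map g) ◁ η.naturality h ⊗≫
        (F.mapComp f g ▷ F.map h ≫ F.mapComp (f ≫ g) h ≫ F.map₂ (α_ f g h).hom) ▷ η.app d := by
      rw [← whisker_exchange]; bicategory
    _ = _ := by rw [F.map₂_associator]; bicategory

/-- The passage occurs in `f`, so `g` and `h` both lie in the `G` end and their naturality cells are
pasted by `naturality_comp`. -/
lemma associator_aux₃ (f : a ⟶ b) (g : b ⟶ c) (h : c ⟶ d) :
    ((α_ _ _ _).hom ≫ F.map f ◁ η.naturality g ≫ (α_ _ _ _).inv ≫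
          F.mapComp f g ▷ η.app c) ▷ G.map h ≫
        ((α_ _ _ _).hom ≫ F.map (f ≫ g) ◁ η.naturality h ≫ (α_ _ _ _).inv ≫
          F.mapComp (f ≫ g) h ▷ η.app d) ≫ F.map₂ (α_ f g h).hom ▷ η.app d =
      (α_ _ _ _).hom ≫ (F.map f ≫ η.app b) ◁ G.mapComp g h ≫ (α_ _ _ _).hom ≫
        F.map f ◁ η.naturality (g ≫ h) ≫ (α_ _ _ _).inv ≫ F.mapComp f (g ≫ h) ▷ η.app d :=
  calc
    _ = 𝟙 _ ⊗≫ F.map f ◁ η.naturality g ▷ G.map h ⊗≫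
        (F.mapComp f g ▷ (η.app c ≫ G.map h) ≫ F.map (f ≫ g) ◁ η.naturality h) ⊗≫
        (F.mapComp (f ≫ g) h ≫ F.map₂ (α_ f g h).hom) ▷ η.app d := by bicategory
    _ = 𝟙 _ ⊗≫ F.map f ◁ η.naturality g ▷ G.map h ⊗≫
        (F.map f ≫ F.map g) ◁ η.naturality h ⊗≫
        (F.mapComp f g ▷ F.map h ≫ F.mapComp (f ≫ g) h ≫ F.map₂ (α_ f g h).hom) ▷ η.app d := by
      rw [← whisker_exchange]; bicategory
    _ = 𝟙 _ ⊗≫ F.map f ◁ ((α_ _ _ _).inv ≫ η.naturality g ▷ G.map h ≫ (α_ _ _ _).hom ≫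
        F.map g ◁ η.naturality h ≫ (α_ _ _ _).inv ≫ F.mapComp g h ▷ η.app d) ⊗≫
        F.mapComp f (g ≫ h) ▷ η.app d := by rw [F.map₂_associator]; bicategory
    _ = _ := by rw [← η.naturality_comp]; bicategory

end

end LaxCylinder

open LaxCylinder in
/-- A transformation `F ⇒ G` of lax functors `C ⥤ᴸ D`, as a lax functor on the product of `C` and
`{false < true}`. -/
def laxCylinder : (C × Two) ⥤ᴸ D where
  obj := obj η
  map := map η
  map₂ := map₂ η
  map₂_id {x y} f := by
    obtain ⟨a, ⟨_ | _⟩⟩ := x <;> obtain ⟨b, ⟨_ | _⟩⟩ := y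
    · exact F.map₂_id _
    · exact (congrArg (· ▷ η.app b) (F.map₂_id _)).trans (id_whiskerRight _ _)
    · exact absurd (leOfHom f.2.as) (by simp)
    · exact G.map₂_id _
  map₂_comp {x y f _ _} s t := by
    obtain ⟨a, ⟨_ | _⟩⟩ := x <;> obtain ⟨b, ⟨_ | _⟩⟩ := y
    · exact F.map₂_comp _ _
    · exact (congrArg (· ▷ η.app b) (F.map₂_comp _ _)).trans (comp_whiskerRight _ _ _)
    · exact absurd (leOfHom f.2.as) (by simp)
    · exact G.map₂_comp _ _
  mapId := mapId η
  mapComp := mapComp η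
  mapComp_naturality_left {x y z f f'} s g := by
    obtain ⟨a, ⟨_ | _⟩⟩ := x <;> obtain ⟨b, ⟨_ | _⟩⟩ := y <;> obtain ⟨c, ⟨_ | _⟩⟩ := z
    · exact F.mapComp_naturality_left _ _
    · change ((α_ _ _ _).inv ≫ F.mapComp f.1 g.1 ▷ η.app c) ≫ F.map₂ (s.1 ▷ g.1) ▷ η.app c =
        F.map₂ s.1 ▷ (F.map g.1 ≫ η.app c) ≫ (α_ _ _ _).inv ≫ F.mapComp f'.1 g.1 ▷ η.app c
      rw [Category.assoc, ← comp_whiskerRight, F.mapComp_naturality_left]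
      simp
    · exact absurd (leOfHom g.2.as) (by simp)
    · exact naturality_left_aux η s.1 g.1
    · exact absurd (leOfHom f.2.as) (by simp)
    · exact absurd (leOfHom f.2.as) (by simp)
    · exact absurd (leOfHom g.2.as) (by simp)
    · exact G.mapComp_naturality_left _ _
  mapComp_naturality_right {x y z} f {g g'} s := by
    obtain ⟨a, ⟨_ | _⟩⟩ := x <;> obtain ⟨b, ⟨_ | _⟩⟩ := y <;> obtain ⟨c, ⟨_ | _⟩⟩ := z
    · exact F.mapComp_naturality_right _ _
    · change ((α_ _ _ _).inv ≫ F.mapComp f.1 g.1 ▷ η.app c) ≫ F.map₂ (f.1 ◁ s.1) ▷ η.app c =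
        F.map f.1 ◁ (F.map₂ s.1 ▷ η.app c) ≫ (α_ _ _ _).inv ≫ F.mapComp f.1 g'.1 ▷ η.app c
      rw [Category.assoc, ← comp_whiskerRight, F.mapComp_naturality_right]
      simp
    · exact absurd (leOfHom g.2.as) (by simp)
    · exact naturality_right_aux η f.1 s.1
    · exact absurd (leOfHom f.2.as) (by simp)
    · exact absurd (leOfHom f.2.as) (by simp)
    · exact absurd (leOfHom g.2.as) (by simp)
    · exact G.mapComp_naturality_right _ _
  map₂_associator {x y z w} f g h := by
    obtain ⟨a, ⟨_ | _⟩⟩ := x <;> obtain ⟨b, ⟨_ | _⟩⟩ := y <;> obtain ⟨c, ⟨_ | _⟩⟩ := z <;>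
      obtain ⟨d, ⟨_ | _⟩⟩ := w
    -- Of the sixteen patterns only the five nondecreasing ones are inhabited; they differ in the
    -- 1-cell that passes from `F` to `G`, if any.
    · exact F.map₂_associator _ _ _
    · exact associator_aux₁ f.1 g.1 h.1 (η.app d)
    · exact absurd (leOfHom h.2.as) (by simp)
    · exact associator_aux₂ η f.1 g.1 h.1
    · exact absurd (leOfHom g.2.as) (by simp)
    · exact absurd (leOfHom g.2.as) (by simp)
    · exact absurd (leOfHom h.2.as) (by simp)
    · exact associator_aux₃ η f.1 g.1 h.1
    · exact absurd (leOfHom f.2.as) (by simp)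
    · exact absurd (leOfHom f.2.as) (by simp)
    · exact absurd (leOfHom f.2.as) (by simp)
    · exact absurd (leOfHom f.2.as) (by simp)
    · exact absurd (leOfHom g.2.as) (by simp)
    · exact absurd (leOfHom g.2.as) (by simp)
    · exact absurd (leOfHom h.2.as) (by simp)
    · exact G.map₂_associator _ _ _
  map₂_leftUnitor {x y} f := by
    obtain ⟨a, ⟨_ | _⟩⟩ := x <;> obtain ⟨b, ⟨_ | _⟩⟩ := y
    · exact F.map₂_leftUnitor _
    · change F.map₂ (λ_ f.1).inv ▷ η.app b = (λ_ (F.map f.1 ≫ η.app b)).inv ≫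
        F.mapId a ▷ (F.map f.1 ≫ η.app b) ≫ (α_ _ _ _).inv ≫ F.mapComp (𝟙 a) f.1 ▷ η.app b
      rw [F.map₂_leftUnitor]
      bicategory
    · exact absurd (leOfHom f.2.as) (by simp)
    · exact G.map₂_leftUnitor _
  map₂_rightUnitor {x y} f := by
    obtain ⟨a, ⟨_ | _⟩⟩ := x <;> obtain ⟨b, ⟨_ | _⟩⟩ := y
    · exact F.map₂_rightUnitor _
    · change F.map₂ (ρ_ f.1).inv ▷ η.app b = (ρ_ (F.map f.1 ≫ η.app b)).inv ≫
        (F.map f.1 ≫ η.app b) ◁ G.mapId b ≫ (α_ _ _ _).hom ≫ F.map f.1 ◁ η.naturality (𝟙 b) ≫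
        (α_ _ _ _).inv ≫ F.mapComp f.1 (𝟙 b) ▷ η.app b
      rw [F.map₂_rightUnitor]
      symm
      calc
        _ = 𝟙 _ ⊗≫ F.map f.1 ◁ (η.app b ◁ G.mapId b ≫ η.naturality (𝟙 b)) ⊗≫
          F.mapComp f.1 (𝟙 b) ▷ η.app b := by bicategory
        -- The unit of `G` is carried through `η` and becomes the unit of `F`.
        _ = _ := by rw [η.naturality_id]; bicategory
    · exact absurd (leOfHom f.2.as) (by simp)
    · exact G.map₂_rightUnitor _

end Cylinder

/-! ### Simplicial homotopies. -/

namespace SSet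

/-- A simplicial homotopy from `f` to `g`, with the simplices of `Δ[1]` written as nondecreasing
maps to `{false < true}`. -/
structure SimplicialHomotopy {X Y : SSet.{u}} (f g : X ⟶ Y) where
  h {n : SimplexCategory} (x : X.obj (op n)) (χ : Fin (n.len + 1) →o Bool) : Y.obj (op n)
  naturality {m n : SimplexCategory} (θ : m ⟶ n) (x : X.obj (op n))
    (χ : Fin (n.len + 1) →o Bool) :
    Y.map θ.op (h x χ) = h (X.map θ.op x) (χ.comp θ.toOrderHom)
  h_false {n : SimplexCategory} (x : X.obj (op n)) : h x (OrderHom.const _ false) = f.app _ x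
  h_true {n : SimplexCategory} (x : X.obj (op n)) : h x (OrderHom.const _ true) = g.app _ x

end SSet

/-! ### From transformations of lax functors to homotopies of geometric nerves. -/

section NerveHomotopy

open LaxCylinder

/-- The lax functor to the product of `C` and `{false < true}` whose components are a lax functor
`[n] ⥤ᴸ C` and a nondecreasing map. -/
def laxPair {C : Type u₁} [Bicategory.{w₁, v₁} C] {n : ℕ} (z : OrdBicat n ⥤ᴸ C)
    (χ : Fin (n + 1) →o Bool) : OrdBicat n ⥤ᴸ C × Two where
  obj i := (z.obj i, ⟨χ i.as⟩)
  map f := (z.map f, ⟨homOfLE (χ.monotone (leOfHom f.as))⟩)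
  map₂ θ := (z.map₂ θ, eqToHom rfl)
  map₂_id f := Prod.ext (z.map₂_id f) (Subsingleton.elim _ _)
  map₂_comp s t := Prod.ext (z.map₂_comp s t) (Subsingleton.elim _ _)
  mapId a := (z.mapId a, eqToHom rfl)
  mapComp f g := (z.mapComp f g, eqToHom rfl)
  mapComp_naturality_left s g := Prod.ext (z.mapComp_naturality_left s g) (Subsingleton.elim _ _)
  mapComp_naturality_right f _ _ s :=
    Prod.ext (z.mapComp_naturality_right f s) (Subsingleton.elim _ _)
  map₂_associator f g h := Prod.ext (z.map₂_associator f g h) (Subsingleton.elim _ _)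
  map₂_leftUnitor f := Prod.ext (z.map₂_leftUnitor f) (Subsingleton.elim _ _)
  map₂_rightUnitor f := Prod.ext (z.map₂_rightUnitor f) (Subsingleton.elim _ _)

/-- This gives the naturality of the homotopy in `[n]`. The 2-cells in the factor `{false < true}`
are unique, so only the factor `C` carries information. -/
lemma ordMap_comp_laxPair {C : Type u₁} [Bicategory.{w₁, v₁} C] {m n : ℕ}
    (σ : Fin (m + 1) →o Fin (n + 1)) (z : OrdBicat n ⥤ᴸ C) (χ : Fin (n + 1) →o Bool) :
    (ordMap σ).comp (laxPair z χ) = laxPair ((ordMap σ).comp z) (χ.comp σ) :=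
  lax_eq_of rfl
    (fun _ => heq_of_eq (Prod.ext rfl (Subsingleton.elim _ _)))
    (fun _ _ => heq_of_eq (Prod.ext rfl (Subsingleton.elim _ _)))

variable {C : Type u} [Bicategory.{u, u} C] {D : Type u} [Bicategory.{u, u} D]
  {F G : C ⥤ᴸ D}

/-- A transformation of lax functors induces a homotopy between the maps of nerves. -/
def nerveHomotopy (η : Lax.LaxTrans F G) :
    SSet.SimplicialHomotopy (geometricNerveMap F) (geometricNerveMap G) where
  h z χ := (laxPair z χ).comp (laxCylinder η)
  naturality {m n} θ z χ := by
    refine (lax_comp_assoc (ordMap θ.toOrderHom) (laxPair z χ) (laxCylinder η)).symm.trans ?_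
    exact congrArg (fun w => LaxFunctor.comp w (laxCylinder η))
      (ordMap_comp_laxPair θ.toOrderHom z χ)
  h_false z := rfl
  h_true z := rfl

end NerveHomotopy

/-! ### The prism decomposition of `Δⁿ × [0,1]` in barycentric coordinates. -/

namespace stdSimplexPrism

/-- A continuous map glued from finitely many maps on the consecutive slabs cut out by a decreasing
sequence of continuous functions. -/
lemma exists_glue {Z W : Type*} [TopologicalSpace Z] [TopologicalSpace W] (s : Z → ℝ)
    (hs : Continuous s) (T : ℕ → Z → ℝ) (hT : ∀ k, Continuous (T k)) (hT' : ∀ z, Antitone (T · z))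
    (f : ℕ → Z → W) (hf : ∀ k, Continuous (f k))
    (hf' : ∀ k z, s z = T (k + 1) z → f k z = f (k + 1) z) (n : ℕ) :
    ∃ g : C(Z, W), ∀ k ≤ n, ∀ z, T (k + 1) z ≤ s z → s z ≤ T k z → g z = f k z := by
  induction n with
  | zero => exact ⟨⟨f 0, hf 0⟩, fun k hk z _ _ => by rw [Nat.le_zero.1 hk]; rfl⟩
  | succ n ih =>
    obtain ⟨g, hg⟩ := ih
    classical
    have hc : ∀ z, s z = T (n + 1) z → f (n + 1) z = g z := fun z hz => by
      rw [hg n le_rfl z hz.ge (hz.le.trans (hT' z n.le_succ)), hf' n z hz]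
    refine ⟨⟨fun z => if s z ≤ T (n + 1) z then f (n + 1) z else g z,
      (hf _).if_le g.continuous hs (hT _) hc⟩, fun k hk z h₁ h₂ => ?_⟩
    change (if s z ≤ T (n + 1) z then f (n + 1) z else g z) = f k z
    rcases Nat.le_succ_iff.1 hk with hk | rfl
    · split_ifs with h
      -- The earlier slabs lie at or above the level `T (n + 1)`, so the two branches can compete
      -- only on that level, where they agree.
      · have e : s z = T (n + 1) z :=
          le_antisymm h ((hT' z (Nat.succ_le_succ hk)).trans h₁)
        rw [hc z e, hg k hk z h₁ h₂]
      · exact hg k hk z h₁ h₂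
    · exact if_pos h₂

variable {n : ℕ}

/-- The sum of the barycentric coordinates with index at least `k`. -/
noncomputable def tail (t : stdSimplex ℝ (Fin (n + 1))) (k : ℕ) : ℝ :=
  ∑ i : Fin (n + 1), if k ≤ (i : ℕ) then t i else 0

lemma tail_antitone (t : stdSimplex ℝ (Fin (n + 1))) : Antitone (tail t) := fun k l h =>
  Finset.sum_le_sum fun i _ => by
    have := t.2.1 i
    split_ifs <;> first | rfl | omega

lemma continuous_tail (k : ℕ) : Continuous fun t : stdSimplex ℝ (Fin (n + 1)) => tail t k :=
  continuous_finsetSum _ fun i _ => by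
    split_ifs
    · exact (continuous_apply i).comp continuous_subtype_val
    · exact continuous_const

lemma tail_zero (t : stdSimplex ℝ (Fin (n + 1))) : tail t 0 = 1 := by
  simp [tail]

lemma tail_of_lt (t : stdSimplex ℝ (Fin (n + 1))) {k : ℕ} (h : n < k) : tail t k = 0 :=
  Finset.sum_eq_zero fun i _ => if_neg (by omega)

/-- Over `t` the `k`-th slab has thickness `t k`, the weight that can be moved between the two
copies of vertex `k`. -/
lemma tail_eq_add (t : stdSimplex ℝ (Fin (n + 1))) (k : Fin (n + 1)) :
    tail t k = t k + tail t (k + 1) := by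
  have h : t k = ∑ i, if i = k then t i else 0 := by simp
  rw [h, tail, tail, ← Finset.sum_add_distrib]
  refine Finset.sum_congr rfl fun i _ => ?_
  by_cases h₁ : i = k
  · subst h₁; simp
  · have h₂ : (i : ℕ) ≠ k := fun e => h₁ (Fin.ext e)
    by_cases h₃ : (k : ℕ) ≤ i
    · rw [if_pos h₃, if_neg h₁, if_pos (by omega), zero_add]
    · rw [if_neg h₃, if_neg h₁, if_neg (by omega), zero_add]

lemma map_apply {m : ℕ} (θ : Fin (m + 1) → Fin (n + 1)) (t : stdSimplex ℝ (Fin (m + 1)))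
    (j : Fin (n + 1)) : stdSimplex.map θ t j = ∑ i, if θ i = j then t i else 0 := by
  rw [stdSimplex.map_coe, FunOnFinite.linearMap_apply_apply, Finset.sum_filter]

/-- Sums against the image of a point of the simplex. -/
lemma sum_map {m : ℕ} (θ : Fin (m + 1) → Fin (n + 1)) (t : stdSimplex ℝ (Fin (m + 1)))
    (g : Fin (n + 1) → ℝ) : ∑ j, stdSimplex.map θ t j * g j = ∑ i, t i * g (θ i) := by
  simp only [map_apply, Finset.sum_mul]
  rw [Finset.sum_comm]
  refine Finset.sum_congr rfl fun i _ => ?_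
  simp [ite_mul]

lemma tail_eq_sum (t : stdSimplex ℝ (Fin (n + 1))) (k : ℕ) :
    tail t k = ∑ i : Fin (n + 1), t i * (if k ≤ (i : ℕ) then 1 else 0) := by
  simp [tail]

/-- The height in the `k`-th slab, clamped to it. -/
noncomputable def height (k : ℕ) (t : stdSimplex ℝ (Fin (n + 1))) (s : ℝ) : ℝ :=
  max (tail t (k + 1)) (min s (tail t k)) - tail t (k + 1)

lemma height_eq (k : ℕ) (t : stdSimplex ℝ (Fin (n + 1))) (s : ℝ) (h₁ : tail t (k + 1) ≤ s)
    (h₂ : s ≤ tail t k) : height k t s = s - tail t (k + 1) := by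
  rw [height, min_eq_left h₂, max_eq_right h₁]

/-- The affine coordinates of the `k`-th prism. -/
noncomputable def prism (k : Fin (n + 1)) (t : stdSimplex ℝ (Fin (n + 1))) (s : ℝ) :
    stdSimplex ℝ (Fin (n + 2)) :=
  ⟨fun j => stdSimplex.map k.succ.succAbove t j +
      height k t s * ((if j = k.succ then 1 else 0) - (if j = k.castSucc then 1 else 0)), by
    -- Weight `height k t s` moves from the lower copy `k.castSucc` of vertex `k` to the upper copy
    -- `k.succ`. Clamping keeps it between `0` and `t k`, so the coordinates stay nonnegative for
    -- every real `s`.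
    have h0 : 0 ≤ height k t s := sub_nonneg.2 (le_max_left _ _)
    have h1 : height k t s ≤ t k := by
      have := tail_eq_add t k
      have h : max (tail t (k + 1)) (min s (tail t k)) ≤ tail t k :=
        max_le (tail_antitone t (Nat.le_succ k)) (min_le_right _ _)
      rw [height]; linarith
    constructor
    · intro j
      have hm := (stdSimplex.map k.succ.succAbove t).2.1 j
      change 0 ≤ stdSimplex.map k.succ.succAbove t j + _
      by_cases h₁ : j = k.castSucc
      · have h₂ : j ≠ k.succ := by rw [h₁]; exact (Fin.castSucc_lt_succ).ne
        have h₃ : t k ≤ stdSimplex.map k.succ.succAbove t j := by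
          rw [map_apply]
          refine le_trans (le_of_eq ?_) (Finset.single_le_sum (f := fun i =>
            if k.succ.succAbove i = j then t i else 0) (fun i _ => ?_) (Finset.mem_univ k))
          · simp [h₁]
          · have := t.2.1 i
            change 0 ≤ if _ then t i else 0
            split_ifs
            · exact this
            · rfl
        rw [if_neg h₂, if_pos h₁]
        linarith
      · rw [if_neg h₁, sub_zero]
        have : 0 ≤ stdSimplex.map k.succ.succAbove t j := hm
        split_ifs <;> linarith
    · have h : ∑ j, stdSimplex.map k.succ.succAbove t j = 1 :=
        (stdSimplex.map k.succ.succAbove t).2.2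
      rw [Finset.sum_add_distrib, h, ← Finset.mul_sum]
      simp⟩

lemma prism_apply (k : Fin (n + 1)) (t : stdSimplex ℝ (Fin (n + 1))) (s : ℝ) (j : Fin (n + 2)) :
    prism k t s j = stdSimplex.map k.succ.succAbove t j +
      height k t s * ((if j = k.succ then 1 else 0) - (if j = k.castSucc then 1 else 0)) := rfl

lemma continuous_height (k : ℕ) :
    Continuous fun z : stdSimplex ℝ (Fin (n + 1)) × ℝ => height k z.1 z.2 := by
  have h₁ := (continuous_tail (n := n) k).comp (continuous_fst (Y := ℝ))
  have h₂ := (continuous_tail (n := n) (k + 1)).comp (continuous_fst (Y := ℝ))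
  exact (h₂.max (continuous_snd.min h₁)).sub h₂

lemma continuous_prism (k : Fin (n + 1)) :
    Continuous fun z : stdSimplex ℝ (Fin (n + 1)) × ℝ => prism k z.1 z.2 := by
  refine Continuous.subtype_mk (continuous_pi fun j => ?_) _
  refine Continuous.add ?_ ((continuous_height k).mul continuous_const)
  exact (continuous_apply j).comp (continuous_subtype_val.comp
    ((stdSimplex.continuous_map _).comp continuous_fst))

/-- At the bottom of the slab no weight has reached the upper copy of vertex `k`. -/
lemma prism_bot (k : Fin (n + 1)) (t : stdSimplex ℝ (Fin (n + 1))) {s : ℝ}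
    (h : s = tail t (k + 1)) : prism k t s = stdSimplex.map k.succ.succAbove t := by
  refine stdSimplex.ext (funext fun j => ?_)
  rw [prism_apply, height_eq k t s h.ge (h.le.trans (tail_antitone t (Nat.le_succ k))), h]
  simp

/-- At the top of the slab all the weight `t k` has left the lower copy of vertex `k`. -/
lemma prism_top (k : Fin (n + 1)) (t : stdSimplex ℝ (Fin (n + 1))) {s : ℝ}
    (h : s = tail t k) : prism k t s = stdSimplex.map k.castSucc.succAbove t := by
  refine stdSimplex.ext (funext fun j => ?_)
  have e := tail_eq_add t k
  rw [prism_apply, height_eq k t s ((tail_antitone t (Nat.le_succ k)).trans h.ge) h.le, h,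
    show tail t k - tail t (k + 1) = t k by linarith, map_apply, map_apply,
    eq_comm, ← sub_eq_iff_eq_add', ← Finset.sum_sub_distrib]
  -- The two face inclusions differ only at `k`, so a single summand survives in the difference.
  rw [Finset.sum_eq_single k]
  · simp [mul_sub, eq_comm]
  · intro i _ hi
    have : k.castSucc.succAbove i = k.succ.succAbove i := by
      rcases lt_or_gt_of_ne hi with h | h
      · rw [Fin.succAbove_of_castSucc_lt _ _ (Fin.castSucc_lt_castSucc_iff.2 h),
          Fin.succAbove_of_castSucc_lt _ _
            ((Fin.castSucc_lt_castSucc_iff.2 h).trans Fin.castSucc_lt_succ)]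
      · rw [Fin.succAbove_of_lt_succ _ _ (Fin.castSucc_lt_succ_iff.2 h.le),
          Fin.succAbove_of_lt_succ _ _ (Fin.succ_lt_succ_iff.2 h)]
    rw [this, sub_self]
  · simp

/-- The nondecreasing map between the prisms over `θ`. -/
def lift {m : ℕ} (θ : Fin (m + 1) →o Fin (n + 1)) (k : Fin (m + 1)) :
    Fin (m + 2) →o Fin (n + 2) where
  toFun i := if i ≤ k.castSucc then (θ (k.predAbove i)).castSucc else (θ (k.predAbove i)).succ
  monotone' i j h := by
    have e := θ.monotone (k.predAbove_right_monotone h)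
    dsimp only
    split_ifs with h₁ h₂ h₂
    · exact Fin.castSucc_le_castSucc_iff.2 e
    · exact (Fin.castSucc_le_castSucc_iff.2 e).trans Fin.castSucc_lt_succ.le
    · exact absurd (h.trans h₂) h₁
    · exact Fin.succ_le_succ_iff.2 e

/-- Monotonicity of `θ` sends indices from `k` on to indices from `θ k` on. With `tail_map_succ_le`,
this places the `k`-th slab over `t` inside the `θ k`-th slab over the image of `t`. -/
lemma tail_map_le {m : ℕ} (θ : Fin (m + 1) →o Fin (n + 1)) (t : stdSimplex ℝ (Fin (m + 1)))
    (k : Fin (m + 1)) : tail t k ≤ tail (stdSimplex.map θ t) (θ k) := by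
  rw [tail_eq_sum, tail_eq_sum, sum_map]
  refine Finset.sum_le_sum fun i _ => mul_le_mul_of_nonneg_left ?_ (t.2.1 i)
  by_cases h : k ≤ i
  · rw [if_pos (show (k : ℕ) ≤ i from h), if_pos (show (θ k : ℕ) ≤ θ i from θ.monotone h)]
  · rw [if_neg (show ¬ (k : ℕ) ≤ i from h)]
    split_ifs <;> norm_num

/-- An index whose image exceeds `θ k` must itself exceed `k`. -/
lemma tail_map_succ_le {m : ℕ} (θ : Fin (m + 1) →o Fin (n + 1))
    (t : stdSimplex ℝ (Fin (m + 1))) (k : Fin (m + 1)) :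
    tail (stdSimplex.map θ t) (θ k + 1) ≤ tail t (k + 1) := by
  rw [tail_eq_sum, tail_eq_sum, sum_map]
  refine Finset.sum_le_sum fun i _ => mul_le_mul_of_nonneg_left ?_ (t.2.1 i)
  by_cases h : k < i
  · rw [if_pos (show (k : ℕ) + 1 ≤ i from h)]
    split_ifs <;> norm_num
  · have := θ.monotone (not_lt.1 h)
    rw [if_neg (show ¬ ((θ k : ℕ) + 1 ≤ θ i) from not_lt.2 this)]
    split_ifs <;> norm_num

end stdSimplexPrism

/-! ### The lax section of the projection and the oplax transformation to the identity. -/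

namespace HoFiberTotal
open HoFiber

variable {A : Type u₁} [Bicategory.{w₁, v₁} A] {B : Type u₂} [Bicategory.{w₂, v₂} B]
  {F : A ⥤ᴸ B}

section
variable {X Y Z : HoFiberTotal F}

/-- The 2-cell of `B` underlying a 1-cell. -/
def side (f : X ⟶ Y) : X.pt.arr ≫ dir f ⟶ F.map (low f) ≫ Y.pt.arr := cell (fib f)

/-- A 2-cell of the total bicategory from compatible 2-cells of `A` and `B`. -/
def cellMk {f g : X ⟶ Y} (σ : dir f ⟶ dir g) (α : low f ⟶ low g)
    (h : side f ≫ F.map₂ α ▷ Y.pt.arr = X.pt.arr ◁ σ ≫ side g) : f ⟶ g :=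
  mk₂ σ (hom₂Mk (α ≫ (λ_ (low g)).inv)
    (shift_w (h.trans (vert_comp_w (X.pt.arr ◁ σ) (fib g)).symm)))

lemma bar_cellMk {f g : X ⟶ Y} (σ : dir f ⟶ dir g) (α : low f ⟶ low g)
    (h : side f ≫ F.map₂ α ▷ Y.pt.arr = X.pt.arr ◁ σ ≫ side g) : bar (cellMk σ α h) = α :=
  (Category.assoc _ _ _).trans (by simp)

/-- The composite begins with a vertical 1-cell over an identity, coming from `chi`. Once its unit
constraint is removed, the plain pasting of the two 2-cells is left. -/
lemma side_comp (f : X ⟶ Y) (g : Y ⟶ Z) :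
    side (f ≫ g) ≫ F.map₂ (λ_ (low f ≫ low g)).hom ▷ Z.pt.arr =
      (α_ _ _ _).inv ≫ side f ▷ dir g ≫ (α_ _ _ _).hom ≫ F.map (low f) ◁ side g ≫
        (α_ _ _ _).inv ≫ F.mapComp (low f) (low g) ▷ Z.pt.arr := by
  refine (vert_comp_w (α_ X.pt.arr (dir f) (dir g)).inv
    ((push F (dir g)).map (fib f) ≫ fib g)).trans ?_
  change (α_ _ _ _).inv ≫ (side f ▷ dir g ≫ (α_ _ _ _).hom) ≫ F.map (low f) ◁ side g ≫
        (α_ _ _ _).inv ≫ F.mapComp (low f) (low g) ▷ Z.pt.arr = _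
  simp

end

/-- The object `(1, a)` over `F a`. -/
def secObj (F : A ⥤ᴸ B) (a : A) : HoFiberTotal F := ⟨F.obj a, ⟨a, 𝟙 (F.obj a)⟩⟩

/-- The 1-cell of the total bicategory with prescribed components. -/
def mk₁ {X Y : HoFiberTotal F} (p : X.base ⟶ Y.base) (u : X.pt.base ⟶ Y.pt.base)
    (β : X.pt.arr ≫ p ⟶ F.map u ≫ Y.pt.arr) : X ⟶ Y :=
  Hom.mk p (homMk u β)

/-- The 1-cell `(1, a) ⟶ (1, a')` given by a 1-cell of `A`. -/
def secMap (F : A ⥤ᴸ B) {a a' : A} (u : a ⟶ a') : secObj F a ⟶ secObj F a' :=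
  mk₁ (F.map u) u ((λ_ (F.map u)).hom ≫ (ρ_ (F.map u)).inv)

section
variable {a b c : A}

/-- The 2-cell of the total bicategory given by a 2-cell of `A`. -/
def secMap₂ (F : A ⥤ᴸ B) {u v : a ⟶ b} (α : u ⟶ v) : secMap F u ⟶ secMap F v :=
  cellMk (F.map₂ α) α (by
    change ((λ_ (F.map u)).hom ≫ (ρ_ (F.map u)).inv) ≫ F.map₂ α ▷ 𝟙 _ =
      𝟙 _ ◁ F.map₂ α ≫ (λ_ (F.map v)).hom ≫ (ρ_ (F.map v)).inv
    simp)

/-- The unit constraint of the section. -/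
def secId (F : A ⥤ᴸ B) (a : A) : 𝟙 (secObj F a) ⟶ secMap F (𝟙 a) :=
  cellMk (F.mapId a) (𝟙 (𝟙 a)) (by
    change ((ρ_ (𝟙 (F.obj a))).hom ≫ (λ_ (𝟙 (F.obj a))).inv ≫ F.mapId a ▷ 𝟙 _) ≫
      F.map₂ (𝟙 (𝟙 a)) ▷ 𝟙 _ = 𝟙 _ ◁ F.mapId a ≫ (λ_ (F.map (𝟙 a))).hom ≫
        (ρ_ (F.map (𝟙 a))).inv
    rw [F.map₂_id]
    bicategory)

/-- The composition constraint of the section. -/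
def secComp (F : A ⥤ᴸ B) (u : a ⟶ b) (v : b ⟶ c) :
    secMap F u ≫ secMap F v ⟶ secMap F (u ≫ v) :=
  cellMk (F.mapComp u v) (λ_ (u ≫ v)).hom (by
    refine (side_comp (secMap F u) (secMap F v)).trans ?_
    change (α_ (𝟙 _) _ _).inv ≫ ((λ_ (F.map u)).hom ≫ (ρ_ (F.map u)).inv) ▷ F.map v ≫
      (α_ _ _ _).hom ≫ F.map u ◁ ((λ_ (F.map v)).hom ≫ (ρ_ (F.map v)).inv) ≫
      (α_ _ _ _).inv ≫ F.mapComp u v ▷ 𝟙 _ = 𝟙 _ ◁ F.mapComp u v ≫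
        (λ_ (F.map (u ≫ v))).hom ≫ (ρ_ (F.map (u ≫ v))).inv
    bicategory)

end

lemma bar_whiskerLeft {X Y Z : HoFiberTotal F} (f : X ⟶ Y) {g h : Y ⟶ Z} (η : g ⟶ h) :
    bar (f ◁ η) = 𝟙 X.pt.base ◁ (low f ◁ bar η) := bar_wl f η

lemma bar_whiskerRight {X Y Z : HoFiberTotal F} {f g : X ⟶ Y} (η : f ⟶ g) (h : Y ⟶ Z) :
    bar (η ▷ h) = 𝟙 X.pt.base ◁ (bar η ▷ low h) := bar_wr η h

section
variable {a b c d : A}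

lemma bar_secMap₂ {u v : a ⟶ b} (α : u ⟶ v) : bar (secMap₂ F α) = α := bar_cellMk _ _ _
lemma bar_secId (a : A) : bar (secId F a) = 𝟙 (𝟙 a) := bar_cellMk _ _ _
lemma bar_secComp (u : a ⟶ b) (v : b ⟶ c) : bar (secComp F u v) = (λ_ (u ≫ v)).hom :=
  bar_cellMk _ _ _

/-- The part in `A` of the associativity law of the section; only constraint cells occur. -/
lemma sec_associator_aux (u : a ⟶ b) (v : b ⟶ c) (w : c ⟶ d) :
    𝟙 a ◁ ((λ_ (u ≫ v)).hom ▷ w) ≫ (λ_ ((u ≫ v) ≫ w)).hom ≫ (α_ u v w).hom =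
      (lowAssoc u v w).hom ≫ 𝟙 a ◁ (u ◁ (λ_ (v ≫ w)).hom) ≫ (λ_ (u ≫ v ≫ w)).hom := by
  simp [lowAssoc]

lemma sec_leftUnitor_aux (u : a ⟶ b) :
    (λ_ u).inv = (lowLeft u).inv ≫ 𝟙 a ◁ (𝟙 (𝟙 a) ▷ u) ≫ (λ_ (𝟙 a ≫ u)).hom := by
  simp [lowLeft]

lemma sec_rightUnitor_aux (u : a ⟶ b) :
    (ρ_ u).inv = (lowRight u).inv ≫ 𝟙 a ◁ (u ◁ 𝟙 (𝟙 b)) ≫ (λ_ (u ≫ 𝟙 b)).hom := by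
  simp [lowRight]

end

/-- The lax section `a ↦ (1, a, F a)` of the projection. -/
def sec (F : A ⥤ᴸ B) : A ⥤ᴸ HoFiberTotal F where
  obj := secObj F
  map := secMap F
  map₂ := secMap₂ F
  -- In every law below, the component in `B` is literally the corresponding law of `F`, and only
  -- the component in `A` needs work.
  map₂_id u := hom₂_ext (F.map₂_id u) ((bar_secMap₂ _).trans (bar_id (secMap F u)).symm)
  map₂_comp s t := hom₂_ext (F.map₂_comp s t) (by
    rw [bar_comp, bar_secMap₂, bar_secMap₂, bar_secMap₂]
    rfl)
  mapId := secId F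
  mapComp := secComp F
  mapComp_naturality_left s v := hom₂_ext (F.mapComp_naturality_left s v) (by
    rw [bar_comp, bar_comp, bar_whiskerRight, bar_secComp, bar_secComp, bar_secMap₂, bar_secMap₂]
    exact (leftUnitor_naturality (s ▷ v)).symm)
  mapComp_naturality_right u _ _ s := hom₂_ext (F.mapComp_naturality_right u s) (by
    rw [bar_comp, bar_comp, bar_whiskerLeft, bar_secComp, bar_secComp, bar_secMap₂, bar_secMap₂]
    exact (leftUnitor_naturality (u ◁ s)).symm)
  map₂_associator u v w := hom₂_ext (F.map₂_associator u v w) (by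
    have e : bar (α_ (secMap F u) (secMap F v) (secMap F w)).hom = (lowAssoc u v w).hom :=
      bar_assocIso_hom _ _ _
    rw [bar_comp, bar_comp, bar_comp, bar_comp, bar_whiskerLeft, bar_whiskerRight, e,
      bar_secComp, bar_secComp, bar_secComp, bar_secComp, bar_secMap₂]
    exact sec_associator_aux u v w)
  map₂_leftUnitor u := hom₂_ext (F.map₂_leftUnitor u) (by
    have e : bar (λ_ (secMap F u)).inv = (lowLeft u).inv := bar_leftIso_inv _
    rw [bar_comp, bar_comp, bar_whiskerRight, e, bar_secId, bar_secComp, bar_secMap₂]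
    exact sec_leftUnitor_aux u)
  map₂_rightUnitor u := hom₂_ext (F.map₂_rightUnitor u) (by
    have e : bar (ρ_ (secMap F u)).inv = (lowRight u).inv := bar_rightIso_inv _
    rw [bar_comp, bar_comp, bar_whiskerLeft, e, bar_secId, bar_secComp, bar_secMap₂]
    exact sec_rightUnitor_aux u)

/-- A criterion for equality of prelax functors. -/
lemma prelax_eq_of {C : Type u₃} [Bicategory.{w₃, v₃} C] {D : Type u₄} [Bicategory.{w₄, v₄} D]
    {P Q : PrelaxFunctor C D} (h : P.toPrefunctor = Q.toPrefunctor)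
    (h₂ : ∀ {a b : C} {f g : a ⟶ b} (η : f ⟶ g), HEq (P.map₂ η) (Q.map₂ η)) : P = Q := by
  obtain ⟨⟨P, p⟩, _, _⟩ := P
  obtain ⟨⟨Q, q⟩, _, _⟩ := Q
  obtain rfl : P = Q := h
  obtain rfl : @p = @q := by
    funext _ _ _ _ η
    exact eq_of_heq (h₂ η)
  rfl

/-- The composition constraint of the section lies over a unit constraint, inverse to the constraint
of the projection as a lax functor. The two cancel, so the equality is strict. -/
lemma sec_comp_proj (F : A ⥤ᴸ B) : (sec F).comp (proj F).toLax = LaxFunctor.id A := by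
  refine lax_eq_of ?_ (fun a => ?_) (fun {a b c} u v => ?_)
  · exact prelax_eq_of rfl fun α => heq_of_eq (bar_secMap₂ α)
  · refine heq_of_eq (show 𝟙 (𝟙 a) ≫ bar (secId F a) = 𝟙 (𝟙 a) from ?_)
    rw [bar_secId]
    exact Category.comp_id _
  · refine heq_of_eq (show (λ_ (u ≫ v)).inv ≫ bar (secComp F u v) = 𝟙 (u ≫ v) from ?_)
    rw [bar_secComp]
    exact Iso.inv_hom_id _

section
variable {X Y Z : HoFiberTotal F}

/-- The converse of `cellMk`: together with `hom₂_ext`, it identifies 2-cells with compatible pairs.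
-/
lemma side_w {f g : X ⟶ Y} (θ : f ⟶ g) :
    side f ≫ F.map₂ (bar θ) ▷ Y.pt.arr = X.pt.arr ◁ dir₂ θ ≫ side g := by
  have h : side f ≫ F.map₂ (low₂ θ) ▷ Y.pt.arr =
    cell (vert (F := F) (X.pt.arr ◁ dir₂ θ) ≫ fib g) := two_w (fib₂ θ)
  rw [bar, F.map₂_comp, comp_whiskerRight, ← Category.assoc]
  exact (congrArg (· ≫ F.map₂ (λ_ (low g)).hom ▷ Y.pt.arr) h).trans
    (vert_comp_w (X.pt.arr ◁ dir₂ θ) (fib g))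

/-- Composites carry a leading `𝟙 a`. Naturality of the unit constraint, which is invertible, allows
compatibility to be tested without it. -/
lemma unit_shift {a a' : A} {b : B} {u v : a ⟶ a'} {g : F.obj a' ⟶ b} {p q : F.obj a ⟶ b}
    {x : p ⟶ F.map (𝟙 a ≫ u) ≫ g} {y : q ⟶ F.map (𝟙 a ≫ v) ≫ g}
    {x' : p ⟶ F.map u ≫ g} {y' : q ⟶ F.map v ≫ g} {s : p ⟶ q} {α : u ⟶ v}
    (hx : x ≫ F.map₂ (λ_ u).hom ▷ g = x') (hy : y ≫ F.map₂ (λ_ v).hom ▷ g = y')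
    (h : x' ≫ F.map₂ α ▷ g = s ≫ y') : x ≫ F.map₂ (𝟙 a ◁ α) ▷ g = s ≫ y := by
  rw [← cancel_mono (F.map₂ (λ_ v).hom ▷ g), Category.assoc, Category.assoc, hy, ← h, ← hx,
    Category.assoc, ← comp_whiskerRight, ← comp_whiskerRight, ← F.map₂_comp, ← F.map₂_comp,
    leftUnitor_naturality]

lemma unit_shift_inv {a a' : A} {b : B} {u : a ⟶ a'} {g : F.obj a' ⟶ b} {p : F.obj a ⟶ b}
    {x : p ⟶ F.map (𝟙 a ≫ u) ≫ g} {x' : p ⟶ F.map u ≫ g}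
    (hx : x ≫ F.map₂ (λ_ u).hom ▷ g = x') : x = x' ≫ F.map₂ (λ_ u).inv ▷ g := by
  rw [← hx, Category.assoc, ← comp_whiskerRight, ← F.map₂_comp]
  simp

/-- A 2-cell between composites from compatible 2-cells of `A` and `B`. -/
def cellMkComp {Y' : HoFiberTotal F} {f : X ⟶ Y} {g : Y ⟶ Z} {f' : X ⟶ Y'} {g' : Y' ⟶ Z}
    (σ : dir f ≫ dir g ⟶ dir f' ≫ dir g') (α : low f ≫ low g ⟶ low f' ≫ low g')
    (h : ((α_ _ _ _).inv ≫ side f ▷ dir g ≫ (α_ _ _ _).hom ≫ F.map (low f) ◁ side g ≫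
        (α_ _ _ _).inv ≫ F.mapComp (low f) (low g) ▷ Z.pt.arr) ≫ F.map₂ α ▷ Z.pt.arr =
      X.pt.arr ◁ σ ≫ (α_ _ _ _).inv ≫ side f' ▷ dir g' ≫ (α_ _ _ _).hom ≫
        F.map (low f') ◁ side g' ≫ (α_ _ _ _).inv ≫
        F.mapComp (low f') (low g') ▷ Z.pt.arr) : f ≫ g ⟶ f' ≫ g' :=
  cellMk σ (𝟙 X.pt.base ◁ α) (unit_shift (side_comp f g) (side_comp f' g') h)

end

/-- The 1-cell `(1, a, F a) ⟶ (f, a, b)` given by `f`. -/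
def counitApp (X : HoFiberTotal F) : secObj F X.pt.base ⟶ X :=
  mk₁ X.pt.arr (𝟙 X.pt.base) (F.mapId X.pt.base ▷ X.pt.arr)

/-- Interchange slides `β` past the unit cell of `F` at `a`. One unit law of `F` then absorbs that
cell, and the other creates the unit cell at `a'`. -/
lemma counit_aux {a a' : A} {b b' : B} {f : F.obj a ⟶ b} {f' : F.obj a' ⟶ b'} {p : b ⟶ b'}
    {u : a ⟶ a'} (β : f ≫ p ⟶ F.map u ≫ f') :
    ((α_ (𝟙 (F.obj a)) f p).inv ≫ (F.mapId a ▷ f) ▷ p ≫ (α_ _ _ _).hom ≫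
        F.map (𝟙 a) ◁ β ≫ (α_ _ _ _).inv ≫ F.mapComp (𝟙 a) u ▷ f') ≫
        F.map₂ ((λ_ u).hom ≫ (ρ_ u).inv) ▷ f' =
      𝟙 (F.obj a) ◁ β ≫ (α_ _ _ _).inv ≫ ((λ_ (F.map u)).hom ≫ (ρ_ (F.map u)).inv) ▷ f' ≫
        (α_ _ _ _).hom ≫ F.map u ◁ (F.mapId a' ▷ f') ≫ (α_ _ _ _).inv ≫
        F.mapComp u (𝟙 a') ▷ f' := by
  calc
    _ = 𝟙 _ ⊗≫ (F.mapId a ▷ (f ≫ p) ≫ F.map (𝟙 a) ◁ β) ⊗≫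
        (F.mapComp (𝟙 a) u ≫ F.map₂ (λ_ u).hom) ▷ f' ≫ F.map₂ (ρ_ u).inv ▷ f' := by
      rw [F.map₂_comp]; bicategory
    _ = 𝟙 _ ⊗≫ 𝟙 _ ◁ β ⊗≫ (F.mapId a ▷ F.map u ≫ F.mapComp (𝟙 a) u ≫
        F.map₂ (λ_ u).hom) ▷ f' ≫ F.map₂ (ρ_ u).inv ▷ f' := by
      rw [← whisker_exchange]; bicategory
    _ = _ := by
      rw [← F.map₂_leftUnitor_hom, F.map₂_rightUnitor]; bicategory

/-- The naturality 2-cell of the counit. -/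
def counitNat {X Y : HoFiberTotal F} (f : X ⟶ Y) :
    counitApp X ≫ f ⟶ secMap F (low f) ≫ counitApp Y :=
  cellMkComp (f := counitApp X) (g := f) (f' := secMap F (low f)) (g' := counitApp Y)
    (side f) ((λ_ (low f)).hom ≫ (ρ_ (low f)).inv) (counit_aux (side f))

lemma bar_counitNat {X Y : HoFiberTotal F} (f : X ⟶ Y) :
    bar (counitNat f) = 𝟙 X.pt.base ◁ ((λ_ (low f)).hom ≫ (ρ_ (low f)).inv) := by
  unfold counitNat cellMkComp
  exact bar_cellMk _ _ _

section
variable {a b c : A}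

lemma counit_naturality_aux {u v : a ⟶ b} (α : u ⟶ v) :
    𝟙 a ◁ ((λ_ u).hom ≫ (ρ_ u).inv) ≫ 𝟙 a ◁ (α ▷ 𝟙 b) =
      𝟙 a ◁ (𝟙 a ◁ α) ≫ 𝟙 a ◁ ((λ_ v).hom ≫ (ρ_ v).inv) := by
  simp

lemma counit_id_aux (a : A) :
    𝟙 a ◁ (𝟙 a ◁ 𝟙 (𝟙 a)) ≫ 𝟙 a ◁ ((λ_ (𝟙 a)).hom ≫ (ρ_ (𝟙 a)).inv) =
      (lowRight (𝟙 a)).hom ≫ (lowLeft (𝟙 a)).inv ≫ 𝟙 a ◁ ((𝟙 (𝟙 a) ≫ 𝟙 (𝟙 a)) ▷ 𝟙 a) := by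
  simp only [lowRight, lowLeft, Iso.trans_hom, Iso.trans_inv]
  bicategory

/-- The components of the transformation lie over identities of `A`, so only constraints occur and
coherence suffices. -/
lemma counit_comp_aux (u : a ⟶ b) (v : b ⟶ c) :
    𝟙 a ◁ (𝟙 a ◁ 𝟙 (𝟙 a ≫ u ≫ v)) ≫
        𝟙 a ◁ ((λ_ (𝟙 a ≫ u ≫ v)).hom ≫ (ρ_ (𝟙 a ≫ u ≫ v)).inv) =
      (lowAssoc (𝟙 a) u v).inv ≫ 𝟙 a ◁ ((𝟙 a ◁ ((λ_ u).hom ≫ (ρ_ u).inv)) ▷ v) ≫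
        (lowAssoc u (𝟙 b) v).hom ≫ 𝟙 a ◁ (u ◁ (𝟙 b ◁ ((λ_ v).hom ≫ (ρ_ v).inv))) ≫
        (lowAssoc u v (𝟙 c)).inv ≫
        𝟙 a ◁ (((λ_ (u ≫ v)).hom ≫ (λ_ (u ≫ v)).inv) ▷ 𝟙 c) := by
  simp only [lowAssoc, Iso.trans_hom, Iso.trans_inv, whiskerLeftIso_hom, whiskerLeftIso_inv,
    whiskerRightIso_hom, whiskerRightIso_inv, Iso.symm_inv, Iso.symm_hom]
  bicategory

end

/-- The oplax transformation from the composite of the projection and the section to the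
identity. -/
def counit (F : A ⥤ᴸ B) :
    Lax.LaxTrans ((proj F).toLax.comp (sec F)) (LaxFunctor.id (HoFiberTotal F)) where
  app := counitApp
  naturality f := counitNat f
  naturality_naturality {X Y f g} θ := by
    change counitNat f ≫ secMap₂ F (bar θ) ▷ counitApp Y = counitApp X ◁ θ ≫ counitNat g
    -- In `B`, naturality with respect to `θ` is the compatibility condition satisfied by `θ`.
    refine hom₂_ext (side_w θ) ?_
    rw [bar_comp, bar_comp, bar_whiskerLeft, bar_whiskerRight, bar_counitNat, bar_counitNat,
      bar_secMap₂]
    exact counit_naturality_aux (bar θ)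
  naturality_id X := by
    change counitApp X ◁ 𝟙 (𝟙 X) ≫ counitNat (𝟙 X) = (ρ_ (counitApp X)).hom ≫
      (λ_ (counitApp X)).inv ≫ (secId F X.pt.base ≫ secMap₂ F (𝟙 (𝟙 X.pt.base))) ▷ counitApp X
    refine hom₂_ext ?_ ?_
    · change X.pt.arr ◁ 𝟙 (𝟙 X.base) ≫ (ρ_ X.pt.arr).hom ≫ (λ_ X.pt.arr).inv ≫
        F.mapId X.pt.base ▷ X.pt.arr = (ρ_ X.pt.arr).hom ≫ (λ_ X.pt.arr).inv ≫
        (F.mapId X.pt.base ≫ F.map₂ (𝟙 (𝟙 X.pt.base))) ▷ X.pt.arr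
      simp
    · have e : bar (ρ_ (counitApp X)).hom = (lowRight (𝟙 X.pt.base)).hom := bar_rightIso_hom _
      have e' : bar (λ_ (counitApp X)).inv = (lowLeft (𝟙 X.pt.base)).inv := bar_leftIso_inv _
      have h : bar ((ρ_ (counitApp X)).hom ≫ (λ_ (counitApp X)).inv ≫
          (secId F X.pt.base ≫ secMap₂ F (𝟙 (𝟙 X.pt.base))) ▷ counitApp X) =
          (lowRight (𝟙 _)).hom ≫ (lowLeft (𝟙 _)).inv ≫ 𝟙 _ ◁ ((𝟙 _ ≫ 𝟙 _) ▷ 𝟙 _) := by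
        rw [bar_comp, bar_comp, bar_whiskerRight, bar_comp, e, e', bar_secMap₂, bar_secId]
        rfl
      refine Eq.trans ?_ h.symm
      rw [bar_comp, bar_whiskerLeft, bar_counitNat, bar_id]
      exact counit_id_aux X.pt.base
  naturality_comp {X Y Z} f g := by
    change counitApp X ◁ 𝟙 (f ≫ g) ≫ counitNat (f ≫ g) = (α_ _ _ _).inv ≫ counitNat f ▷ g ≫
      (α_ _ _ _).hom ≫ secMap F (low f) ◁ counitNat g ≫ (α_ _ _ _).inv ≫
      (secComp F (low f) (low g) ≫ secMap₂ F (λ_ (low f ≫ low g)).inv) ▷ counitApp Z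
    refine hom₂_ext ?_ ?_
    · change X.pt.arr ◁ 𝟙 (dir f ≫ dir g) ≫ side (f ≫ g) = (α_ X.pt.arr (dir f) (dir g)).inv ≫
        side f ▷ dir g ≫ (α_ _ _ _).hom ≫ F.map (low f) ◁ side g ≫ (α_ _ _ _).inv ≫
        (F.mapComp (low f) (low g) ≫ F.map₂ (λ_ (low f ≫ low g)).inv) ▷ Z.pt.arr
      -- In `B` the law says that the 2-cell of a composite is the pasting of the two 2-cells; the
      -- inverse unit constraint of the projection accounts for the leading identity.
      refine (congrArg (· ≫ _) (Bicategory.whiskerLeft_id _ _)).trans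
        ((Category.id_comp _).trans ((unit_shift_inv (side_comp f g)).trans ?_))
      change ((α_ _ _ _).inv ≫ side f ▷ dir g ≫ (α_ _ _ _).hom ≫ F.map (low f) ◁ side g ≫
        (α_ _ _ _).inv ≫ F.mapComp (low f) (low g) ▷ Z.pt.arr) ≫
        F.map₂ (λ_ (low f ≫ low g)).inv ▷ Z.pt.arr = _
      simp only [comp_whiskerRight, Category.assoc]
    · have e : bar (α_ (counitApp X) f g).inv = (lowAssoc (𝟙 _) (low f) (low g)).inv :=
        bar_assocIso_inv _ _ _
      have e' : bar (α_ (secMap F (low f)) (counitApp Y) g).hom =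
        (lowAssoc (low f) (𝟙 _) (low g)).hom := bar_assocIso_hom _ _ _
      have e'' : bar (α_ (secMap F (low f)) (secMap F (low g)) (counitApp Z)).inv =
        (lowAssoc (low f) (low g) (𝟙 _)).inv := bar_assocIso_inv _ _ _
      have h : bar ((α_ _ _ _).inv ≫ counitNat f ▷ g ≫ (α_ _ _ _).hom ≫
          secMap F (low f) ◁ counitNat g ≫ (α_ _ _ _).inv ≫
          (secComp F (low f) (low g) ≫ secMap₂ F (λ_ (low f ≫ low g)).inv) ▷ counitApp Z) =
          (lowAssoc (𝟙 _) (low f) (low g)).inv ≫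
            𝟙 _ ◁ ((𝟙 _ ◁ ((λ_ (low f)).hom ≫ (ρ_ (low f)).inv)) ▷ low g) ≫
            (lowAssoc (low f) (𝟙 _) (low g)).hom ≫
            𝟙 _ ◁ (low f ◁ (𝟙 _ ◁ ((λ_ (low g)).hom ≫ (ρ_ (low g)).inv))) ≫
            (lowAssoc (low f) (low g) (𝟙 _)).inv ≫
            𝟙 _ ◁ (((λ_ (low f ≫ low g)).hom ≫ (λ_ (low f ≫ low g)).inv) ▷ 𝟙 _) := by
        rw [bar_comp, bar_comp, bar_comp, bar_comp, bar_comp, bar_whiskerLeft,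
          bar_whiskerRight, bar_whiskerRight, bar_comp, e, e', e'',
          bar_counitNat, bar_counitNat, bar_secMap₂, bar_secComp]
        rfl
      refine Eq.trans ?_ h.symm
      rw [bar_comp, bar_whiskerLeft, bar_counitNat, bar_id]
      exact counit_comp_aux (low f) (low g)

end HoFiberTotal

/-! ### Naturality of the prism decomposition. -/

namespace stdSimplexPrism

variable {m n : ℕ}

/-- Testing against functions on the vertices turns pushforwards into substitutions, so fibres of
monotone maps need not be computed. -/
lemma ext_sum {t t' : stdSimplex ℝ (Fin (n + 1))}
    (h : ∀ g : Fin (n + 1) → ℝ, ∑ i, t i * g i = ∑ i, t' i * g i) : t = t' :=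
  stdSimplex.ext (funext fun j => by
    simpa [Pi.single_apply] using h (Pi.single j 1))

lemma sum_prism (k : Fin (n + 1)) (t : stdSimplex ℝ (Fin (n + 1))) (s : ℝ)
    (g : Fin (n + 2) → ℝ) : ∑ j, prism k t s j * g j =
      ∑ i, t i * g (k.succ.succAbove i) + height k t s * (g k.succ - g k.castSucc) := by
  simp only [prism_apply, add_mul, Finset.sum_add_distrib, sum_map, mul_assoc, ← Finset.mul_sum,
    sub_mul, Finset.sum_sub_distrib]
  simp

lemma continuous_slab_prism (k : Fin (n + 1)) :
    Continuous fun z : stdSimplex ℝ (Fin (n + 1)) × unitInterval => prism k z.1 (z.2 : ℝ) :=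
  (continuous_prism k).comp (f := fun z : stdSimplex ℝ (Fin (n + 1)) × unitInterval =>
    (z.1, (z.2 : ℝ))) (continuous_fst.prodMk (continuous_subtype_val.comp continuous_snd))

lemma lift_apply (θ : Fin (m + 1) →o Fin (n + 1)) (k : Fin (m + 1)) (i : Fin (m + 2)) :
    lift θ k i =
      if i ≤ k.castSucc then (θ (k.predAbove i)).castSucc else (θ (k.predAbove i)).succ := rfl

lemma lift_castSucc (θ : Fin (m + 1) →o Fin (n + 1)) (k : Fin (m + 1)) :
    lift θ k k.castSucc = (θ k).castSucc := by simp [lift_apply]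

lemma lift_succ (θ : Fin (m + 1) →o Fin (n + 1)) (k : Fin (m + 1)) :
    lift θ k k.succ = (θ k).succ := by simp [lift_apply]

lemma lift_succAbove (θ : Fin (m + 1) →o Fin (n + 1)) (k i : Fin (m + 1)) :
    lift θ k (k.succ.succAbove i) = if i ≤ k then (θ i).castSucc else (θ i).succ := by
  by_cases h : i ≤ k
  · rw [Fin.succAbove_of_castSucc_lt _ _ (Fin.castSucc_lt_succ_iff.2 h), if_pos h]
    simp [lift_apply, h, Fin.predAbove_castSucc_of_le _ _ h]
  · rw [Fin.succAbove_of_lt_succ _ _ (Fin.succ_lt_succ_iff.2 (not_le.1 h)), if_neg h]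
    have h' : ¬ i.succ ≤ k.castSucc := fun e => h (Fin.castSucc_lt_castSucc_iff.1
      (Fin.castSucc_lt_succ.trans_le e)).le
    simp [lift_apply, h', Fin.predAbove_succ_of_le _ _ (not_le.1 h).le]

lemma succ_succAbove (k i : Fin (n + 1)) :
    k.succ.succAbove i = if i ≤ k then i.castSucc else i.succ := by
  split_ifs with h
  · exact Fin.succAbove_of_castSucc_lt _ _ (Fin.castSucc_lt_succ_iff.2 h)
  · exact Fin.succAbove_of_lt_succ _ _ (Fin.succ_lt_succ_iff.2 (not_le.1 h))

/-- The prism coordinates are natural. -/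
lemma map_lift_prism (θ : Fin (m + 1) →o Fin (n + 1)) (k : Fin (m + 1))
    (t : stdSimplex ℝ (Fin (m + 1))) (s : ℝ) (h₁ : tail t (k + 1) ≤ s) (h₂ : s ≤ tail t k) :
    stdSimplex.map (lift θ k) (prism k t s) = prism (θ k) (stdSimplex.map θ t) s := by
  refine ext_sum fun g => ?_
  rw [sum_map, sum_prism (g := fun i => g (lift θ k i)), sum_prism, sum_map,
    height_eq _ _ _ h₁ h₂, height_eq _ _ _ ((tail_map_succ_le θ t k).trans h₁)
      (h₂.trans (tail_map_le θ t k)), lift_castSucc, lift_succ, tail_eq_sum, tail_eq_sum,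
    sum_map θ t (fun j => if (θ k : ℕ) + 1 ≤ j then (1 : ℝ) else 0)]
  -- The vertices differ only for `i > k` with `θ i = θ k`: the lift places such an `i` in the upper
  -- copy, the target prism in the lower one. The total weight of these `i` is the difference of the
  -- two heights.
  have key : ∀ i, t i * g (lift θ k (k.succ.succAbove i)) =
      t i * g ((θ k).succ.succAbove (θ i)) +
      (t i * (if (k : ℕ) + 1 ≤ i then 1 else 0)) * (g (θ k).succ - g (θ k).castSucc) -
      (t i * (if (θ k : ℕ) + 1 ≤ θ i then 1 else 0)) * (g (θ k).succ - g (θ k).castSucc) := by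
    intro i
    rw [lift_succAbove, succ_succAbove]
    by_cases h : i ≤ k
    · have h' := θ.monotone h
      rw [if_pos h, if_pos h', if_neg (show ¬ (k : ℕ) + 1 ≤ i from not_lt.2 h),
        if_neg (show ¬ (θ k : ℕ) + 1 ≤ θ i from not_lt.2 h')]
      ring
    · rw [if_neg h, if_pos (show (k : ℕ) + 1 ≤ i from not_le.1 h)]
      by_cases h' : θ i ≤ θ k
      · have e : θ i = θ k := le_antisymm h' (θ.monotone (not_le.1 h).le)
        rw [e]
        simp
        ring
      · rw [if_neg h', if_pos (show (θ k : ℕ) + 1 ≤ θ i from not_le.1 h')]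
        ring
  rw [Finset.sum_congr rfl fun i _ => key i, Finset.sum_sub_distrib, Finset.sum_add_distrib,
    ← Finset.sum_mul, ← Finset.sum_mul]
  ring

lemma exists_slab (t : stdSimplex ℝ (Fin (n + 1))) (s : unitInterval) :
    ∃ k : Fin (n + 1), tail t (k + 1) ≤ s ∧ (s : ℝ) ≤ tail t k := by
  classical
  -- The least such index is the slab; `n` is a candidate because the tail beyond it is `0`.
  have h : ∃ k, tail t (k + 1) ≤ s := ⟨n, by rw [tail_of_lt t n.lt_succ_self]; exact s.2.1⟩
  have hn : Nat.find h ≤ n := Nat.find_min' h (by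
    rw [tail_of_lt t n.lt_succ_self]; exact s.2.1)
  refine ⟨⟨Nat.find h, Nat.lt_succ_of_le hn⟩, Nat.find_spec h, ?_⟩
  change (s : ℝ) ≤ tail t (Nat.find h)
  rcases hk : Nat.find h with _ | k
  · rw [tail_zero]; exact s.2.2
  · exact (not_le.1 (Nat.find_min h (m := k) (by omega))).le

/-- The indicator function of the indices at least `k`. -/
def upper (n k : ℕ) : Fin (n + 1) →o Bool where
  toFun i := decide (k ≤ i)
  monotone' i j h := by
    by_cases h' : k ≤ i
    · simp [h', h'.trans h]
    · simp [h']

lemma upper_zero (n : ℕ) : upper n 0 = OrderHom.const _ true :=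
  OrderHom.ext _ _ (funext fun i => decide_eq_true (Nat.zero_le (i : ℕ)))

lemma upper_of_lt {n k : ℕ} (h : n < k) : upper n k = OrderHom.const _ false :=
  OrderHom.ext _ _ (funext fun i => decide_eq_false (by omega))

/-- Omitting the upper copy of vertex `k` leaves `k` at level `false`; omitting the lower copy, as
in `upper_succAbove_castSucc`, leaves it at level `true`. Hence adjacent prisms share a face. -/
lemma upper_succAbove_succ (k i : Fin (n + 1)) :
    upper (n + 1) (k + 1) (k.succ.succAbove i) = upper n (k + 1) i := by
  refine decide_eq_decide.2 ?_
  rw [succ_succAbove]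
  split_ifs with h
  · simp
  · have : k < i := not_le.1 h
    simp only [Fin.val_succ]
    omega

lemma upper_succAbove_castSucc (k i : Fin (n + 1)) :
    upper (n + 1) (k + 1) (k.castSucc.succAbove i) = upper n k i := by
  refine decide_eq_decide.2 ?_
  by_cases h : i < k
  · rw [Fin.succAbove_of_castSucc_lt _ _ (Fin.castSucc_lt_castSucc_iff.2 h), Fin.val_castSucc]
    omega
  · rw [Fin.succAbove_of_le_castSucc _ _ (Fin.castSucc_le_castSucc_iff.2 (not_lt.1 h)),
      Fin.val_succ]
    omega

/-- The lift respects the cut between the two levels. With `predAbove_lift`, it is a map of prisms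
over `θ` in both factors of the product. -/
lemma upper_comp_lift (θ : Fin (m + 1) →o Fin (n + 1)) (k : Fin (m + 1)) :
    (upper (n + 1) (θ k + 1)).comp (lift θ k) = upper (m + 1) (k + 1) := by
  refine OrderHom.ext _ _ (funext fun i => decide_eq_decide.2 ⟨fun h => ?_, fun h => ?_⟩)
  · by_contra h'
    have h₁ : i ≤ k.castSucc := Fin.le_def.2 (Nat.le_of_lt_succ (not_le.1 h'))
    have h₂ := (lift θ k).monotone h₁
    rw [lift_castSucc, Fin.le_def, Fin.val_castSucc] at h₂
    omega
  · have h₁ : k.succ ≤ i := Fin.le_def.2 h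
    have h₂ := (lift θ k).monotone h₁
    rwa [lift_succ, Fin.le_def, Fin.val_succ] at h₂

lemma predAbove_lift (θ : Fin (m + 1) →o Fin (n + 1)) (k : Fin (m + 1)) (i : Fin (m + 2)) :
    (θ k).predAbove (lift θ k i) = θ (k.predAbove i) := by
  rw [lift_apply]
  split_ifs with h
  · have h' := Fin.predAbove_right_monotone k h
    rw [Fin.predAbove_castSucc_self] at h'
    exact Fin.predAbove_castSucc_of_le _ _ (θ.monotone h')
  · have h' := Fin.predAbove_right_monotone k (Fin.castSucc_lt_iff_succ_le.1 (not_le.1 h))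
    rw [Fin.predAbove_succ_self] at h'
    exact Fin.predAbove_succ_of_le _ _ (θ.monotone h')

end stdSimplexPrism

/-! ### Realization of simplicial homotopies. -/

namespace SSet

open stdSimplexPrism Simplicial

lemma app_map {Y W : SSet.{u}} (η : Y ⟶ W) {m n : SimplexCategory} (θ : m ⟶ n)
    (y : Y.obj (op n)) : η.app _ (Y.map θ.op y) = W.map θ.op (η.app _ y) :=
  NatTrans.naturality_apply η θ.op y

/-- The unit of the adjunction between realization and singular complex. -/
noncomputable def realUnit (Y : SSet.{u}) : Y ⟶ TopCat.toSSet.obj (SSet.toTop.obj Y) :=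
  sSetTopAdj.unit.app Y

/-- The point of the realization given by a simplex and barycentric coordinates. -/
noncomputable def realPt (Y : SSet.{u}) {n : SimplexCategory} (y : Y.obj (op n)) :
    C(_root_.stdSimplex ℝ (Fin (n.len + 1)), SSet.toTop.obj Y) :=
  TopCat.toSSetObjEquiv _ _ ((realUnit Y).app _ y)

lemma toSSetObjEquiv_map {Z : TopCat.{u}} {m n : SimplexCategory} (θ : m ⟶ n)
    (z : (TopCat.toSSet.obj Z).obj (op n)) (t : _root_.stdSimplex ℝ (Fin (m.len + 1))) :
    TopCat.toSSetObjEquiv Z _ ((TopCat.toSSet.obj Z).map θ.op z) t =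
      TopCat.toSSetObjEquiv Z _ z (_root_.stdSimplex.map θ.toOrderHom t) := rfl

lemma realPt_map (Y : SSet.{u}) {m n : SimplexCategory} (θ : m ⟶ n) (y : Y.obj (op n))
    (t : _root_.stdSimplex ℝ (Fin (m.len + 1))) :
    realPt Y (Y.map θ.op y) t = realPt Y y (_root_.stdSimplex.map θ.toOrderHom t) := by
  have h : (realUnit Y).app _ (Y.map θ.op y) =
      (TopCat.toSSet.obj (SSet.toTop.obj Y)).map θ.op ((realUnit Y).app _ y) :=
    app_map (realUnit Y) θ y
  unfold realPt
  rw [h]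
  exact toSSetObjEquiv_map θ _ t

namespace SimplicialHomotopy

variable {X Y : SSet.{u}} {f g : X ⟶ Y} (H : SimplicialHomotopy f g)

/-- The image of the `k`-th nondegenerate simplex of the prism over `x`. -/
def prismCell {n : ℕ} (x : X.obj (op ⦋n⦌)) (k : Fin (n + 1)) : Y.obj (op ⦋n + 1⦌) :=
  H.h (n := ⦋n + 1⦌) (X.map (SimplexCategory.σ k).op x) (upper (n + 1) (k + 1))

/-- A face that splits the degeneracy restores `x`, so only the level function changes. -/
lemma map_δ_prismCell {n : ℕ} (x : X.obj (op ⦋n⦌)) (k : Fin (n + 1)) (j : Fin (n + 2))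
    (h : SimplexCategory.δ j ≫ SimplexCategory.σ k = 𝟙 ⦋n⦌) (χ : Fin (n + 1) →o Bool)
    (hχ : ∀ i, upper (n + 1) (k + 1) (j.succAbove i) = χ i) :
    Y.map (SimplexCategory.δ j).op (H.prismCell x k) = H.h (n := ⦋n⦌) x χ := by
  have e : X.map (SimplexCategory.δ j).op (X.map (SimplexCategory.σ k).op x) = x := by
    rw [← Functor.map_comp_apply, ← op_comp, h, op_id, Functor.map_id_apply]
  refine (H.naturality (m := ⦋n⦌) (n := ⦋n + 1⦌) _ _ _).trans ?_
  rw [e]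
  exact congrArg (H.h (n := ⦋n⦌) x) (OrderHom.ext _ _ (funext hχ))

lemma map_δ_succ_prismCell {n : ℕ} (x : X.obj (op ⦋n⦌)) (k : Fin (n + 1)) :
    Y.map (SimplexCategory.δ k.succ).op (H.prismCell x k) =
      H.h (n := ⦋n⦌) x (upper n (k + 1)) :=
  H.map_δ_prismCell x k _ SimplexCategory.δ_comp_σ_succ _ (upper_succAbove_succ k)

lemma map_δ_castSucc_prismCell {n : ℕ} (x : X.obj (op ⦋n⦌)) (k : Fin (n + 1)) :
    Y.map (SimplexCategory.δ k.castSucc).op (H.prismCell x k) =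
      H.h (n := ⦋n⦌) x (upper n k) :=
  H.map_δ_prismCell x k _ SimplexCategory.δ_comp_σ_self _ (upper_succAbove_castSucc k)

lemma map_lift_prismCell {m n : ℕ} (θ : (⦋m⦌ : SimplexCategory) ⟶ ⦋n⦌) (x : X.obj (op ⦋n⦌))
    (k : Fin (m + 1)) :
    Y.map (SimplexCategory.mkHom (lift θ.toOrderHom k)).op
        (H.prismCell x (θ.toOrderHom k)) = H.prismCell (X.map θ.op x) k := by
  have e : SimplexCategory.mkHom (lift θ.toOrderHom k) ≫ SimplexCategory.σ (θ.toOrderHom k) =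
      SimplexCategory.σ k ≫ θ :=
    SimplexCategory.Hom.ext _ _ (OrderHom.ext _ _ (funext (predAbove_lift θ.toOrderHom k)))
  refine (H.naturality (m := ⦋m + 1⦌) (n := ⦋n + 1⦌) _ _ _).trans ?_
  rw [← Functor.map_comp_apply, ← op_comp, e, op_comp, Functor.map_comp_apply]
  exact congrArg (H.h (n := ⦋m + 1⦌) _) (upper_comp_lift θ.toOrderHom k)

lemma realPt_prism_bot {n : ℕ} (x : X.obj (op ⦋n⦌)) (k : Fin (n + 1))
    (t : _root_.stdSimplex ℝ (Fin (n + 1))) {s : ℝ} (h : s = tail t (k + 1)) :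
    realPt Y (H.prismCell x k) (prism k t s) =
      realPt Y (H.h (n := ⦋n⦌) x (upper n (k + 1))) t := by
  rw [prism_bot k t h, ← H.map_δ_succ_prismCell]
  exact (realPt_map Y (SimplexCategory.δ k.succ) _ t).symm

lemma realPt_prism_top {n : ℕ} (x : X.obj (op ⦋n⦌)) (k : Fin (n + 1))
    (t : _root_.stdSimplex ℝ (Fin (n + 1))) {s : ℝ} (h : s = tail t k) :
    realPt Y (H.prismCell x k) (prism k t s) = realPt Y (H.h (n := ⦋n⦌) x (upper n k)) t := by
  rw [prism_top k t h, ← H.map_δ_castSucc_prismCell]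
  exact (realPt_map Y (SimplexCategory.δ k.castSucc) _ t).symm

/-- The homotopy on the `k`-th slab over a simplex. -/
noncomputable def slabMap {n : ℕ} (x : X.obj (op ⦋n⦌)) (k : ℕ)
    (z : _root_.stdSimplex ℝ (Fin (n + 1)) × unitInterval) : SSet.toTop.obj Y :=
  if h : k < n + 1 then realPt Y (H.prismCell x ⟨k, h⟩) (prism ⟨k, h⟩ z.1 z.2)
  -- Beyond the last slab the map continues by its value at the bottom, so that consecutive maps
  -- agree for every natural number `k`, as `exists_glue` requires.
  else realPt Y (H.h (n := ⦋n⦌) x (upper n (n + 1))) z.1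

lemma slabMap_of_lt {n : ℕ} (x : X.obj (op ⦋n⦌)) {k : ℕ} (h : k < n + 1)
    (z : _root_.stdSimplex ℝ (Fin (n + 1)) × unitInterval) :
    H.slabMap x k z = realPt Y (H.prismCell x ⟨k, h⟩) (prism ⟨k, h⟩ z.1 z.2) := dif_pos h

lemma slabMap_of_not_lt {n : ℕ} (x : X.obj (op ⦋n⦌)) {k : ℕ} (h : ¬ k < n + 1)
    (z : _root_.stdSimplex ℝ (Fin (n + 1)) × unitInterval) :
    H.slabMap x k z = realPt Y (H.h (n := ⦋n⦌) x (upper n (n + 1))) z.1 := dif_neg h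

lemma continuous_slabMap {n : ℕ} (x : X.obj (op ⦋n⦌)) (k : ℕ) :
    Continuous (H.slabMap x k) := by
  by_cases h : k < n + 1
  · have hp := continuous_slab_prism (n := n) ⟨k, h⟩
    have hr : Continuous fun w : _root_.stdSimplex ℝ (Fin (n + 2)) =>
      realPt Y (H.prismCell x ⟨k, h⟩) w := (realPt Y (H.prismCell x ⟨k, h⟩)).continuous
    exact (hr.comp hp).congr
      fun z => (H.slabMap_of_lt x h z).symm
  · exact ((realPt Y (H.h (n := ⦋n⦌) x (upper n (n + 1)))).continuous.comp continuous_fst).congr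
      fun z => (H.slabMap_of_not_lt x h z).symm

/-- The bottom face of one prism and the top face of the next are the same simplex. -/
lemma slabMap_succ {n : ℕ} (x : X.obj (op ⦋n⦌)) (k : ℕ)
    (z : _root_.stdSimplex ℝ (Fin (n + 1)) × unitInterval) (hz : (z.2 : ℝ) = tail z.1 (k + 1)) :
    H.slabMap x k z = H.slabMap x (k + 1) z := by
  by_cases h : k < n + 1
  · rw [H.slabMap_of_lt x h, H.realPt_prism_bot x ⟨k, h⟩ z.1 hz]
    by_cases h' : k + 1 < n + 1
    · rw [H.slabMap_of_lt x h', H.realPt_prism_top x ⟨k + 1, h'⟩ z.1 hz]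
    · rw [H.slabMap_of_not_lt x h']
      obtain rfl : k = n := by omega
      rfl
  · rw [H.slabMap_of_not_lt x h, H.slabMap_of_not_lt x (by omega)]

lemma exists_prismMap {n : ℕ} (x : X.obj (op ⦋n⦌)) :
    ∃ Φ : C(_root_.stdSimplex ℝ (Fin (n + 1)) × unitInterval, SSet.toTop.obj Y),
      ∀ (k : Fin (n + 1)) (t : _root_.stdSimplex ℝ (Fin (n + 1))) (s : unitInterval),
        tail t (k + 1) ≤ s → (s : ℝ) ≤ tail t k →
          Φ (t, s) = realPt Y (H.prismCell x k) (prism k t s) := by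
  obtain ⟨Φ, hΦ⟩ := exists_glue
    (fun z : _root_.stdSimplex ℝ (Fin (n + 1)) × unitInterval => (z.2 : ℝ))
    (continuous_subtype_val.comp continuous_snd) (fun k z => tail z.1 k)
    (fun k => (continuous_tail k).comp continuous_fst) (fun z => tail_antitone z.1)
    (H.slabMap x) (H.continuous_slabMap x) (H.slabMap_succ x) n
  exact ⟨Φ, fun k t s h₁ h₂ => (hΦ k (Nat.le_of_lt_succ k.2) (t, s) h₁ h₂).trans
    (H.slabMap_of_lt x k.2 (t, s))⟩

/-- The homotopy on a simplex. -/
noncomputable def prismMap {n : ℕ} (x : X.obj (op ⦋n⦌)) :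
    C(_root_.stdSimplex ℝ (Fin (n + 1)) × unitInterval, SSet.toTop.obj Y) :=
  (H.exists_prismMap x).choose

lemma prismMap_apply {n : ℕ} (x : X.obj (op ⦋n⦌)) (k : Fin (n + 1))
    (t : _root_.stdSimplex ℝ (Fin (n + 1))) (s : unitInterval)
    (h₁ : tail t (k + 1) ≤ s) (h₂ : (s : ℝ) ≤ tail t k) :
    H.prismMap x (t, s) = realPt Y (H.prismCell x k) (prism k t s) :=
  (H.exists_prismMap x).choose_spec k t s h₁ h₂

/-- A slab containing the point over `t` lands in a single slab over the image, and there both the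
coordinates and the cells are natural. -/
lemma prismMap_map {m n : ℕ} (θ : (⦋m⦌ : SimplexCategory) ⟶ ⦋n⦌) (x : X.obj (op ⦋n⦌))
    (t : _root_.stdSimplex ℝ (Fin (m + 1))) (s : unitInterval) :
    H.prismMap (X.map θ.op x) (t, s) =
      H.prismMap x (_root_.stdSimplex.map θ.toOrderHom t, s) := by
  obtain ⟨k, h₁, h₂⟩ := exists_slab t s
  rw [H.prismMap_apply _ k t s h₁ h₂, H.prismMap_apply x (θ.toOrderHom k) _ s
    ((tail_map_succ_le θ.toOrderHom t k).trans h₁) (h₂.trans (tail_map_le θ.toOrderHom t k)),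
    ← map_lift_prism θ.toOrderHom k t s h₁ h₂, ← H.map_lift_prismCell]
  exact realPt_map Y (SimplexCategory.mkHom (lift θ.toOrderHom k)) _ _

lemma prismMap_zero {n : ℕ} (x : X.obj (op ⦋n⦌)) (t : _root_.stdSimplex ℝ (Fin (n + 1))) :
    H.prismMap x (t, 0) = realPt Y (f.app _ x) t := by
  have h : ((0 : unitInterval) : ℝ) = tail t ((Fin.last n : ℕ) + 1) :=
    (tail_of_lt t n.lt_succ_self).symm
  rw [H.prismMap_apply x (Fin.last n) t 0 h.ge
    (h.le.trans (tail_antitone t (Nat.le_succ _))), H.realPt_prism_bot x _ t h, ← H.h_false]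
  exact congrArg (fun χ => realPt Y (H.h (n := ⦋n⦌) x χ) t) (upper_of_lt n.lt_succ_self)

lemma prismMap_one {n : ℕ} (x : X.obj (op ⦋n⦌)) (t : _root_.stdSimplex ℝ (Fin (n + 1))) :
    H.prismMap x (t, 1) = realPt Y (g.app _ x) t := by
  have h : ((1 : unitInterval) : ℝ) = tail t ((0 : Fin (n + 1)) : ℕ) := (tail_zero t).symm
  rw [H.prismMap_apply x 0 t 1 ((tail_antitone t (Nat.le_succ _)).trans h.ge) h.le,
    H.realPt_prism_top x _ t h, ← H.h_true]
  exact congrArg (fun χ => realPt Y (H.h (n := ⦋n⦌) x χ) t) (upper_zero n)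

/-- The space of paths in the realization of `Y`. -/
noncomputable abbrev pathSpace (Y : SSet.{u}) : TopCat.{u} := TopCat.of C(unitInterval, SSet.toTop.obj Y)

/-- The map to the path space corresponding to a simplicial homotopy. -/
noncomputable def toPathSSet : X ⟶ TopCat.toSSet.obj (pathSpace Y) where
  app n := ↾ fun x => (TopCat.toSSetObjEquiv (pathSpace Y) n).symm
    (H.prismMap (n := n.unop.len) x).curry
  naturality m n θ := by
    ext x
    apply (TopCat.toSSetObjEquiv (pathSpace Y) n).injective
    ext t s
    exact H.prismMap_map (m := n.unop.len) (n := m.unop.len) θ.unop x t s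

/-- The map from the realization to the path space corresponding to a simplicial homotopy. -/
noncomputable def toPath : SSet.toTop.obj X ⟶ pathSpace Y :=
  (sSetTopAdj.homEquiv X (pathSpace Y)).symm H.toPathSSet

/-- Evaluation of paths. -/
noncomputable def evalAt (Y : SSet.{u}) (s : unitInterval) : pathSpace Y ⟶ SSet.toTop.obj Y :=
  TopCat.ofHom ⟨fun p => p s, continuous_eval_const s⟩

/-- By adjunction, maps out of the realization are compared on simplices with barycentric
coordinates, where the claim is `hk`. -/
lemma toPath_evalAt (s : unitInterval) (k : X ⟶ Y)
    (hk : ∀ {n : ℕ} (x : X.obj (op ⦋n⦌)) (t : _root_.stdSimplex ℝ (Fin (n + 1))),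
      H.prismMap x (t, s) = realPt Y (k.app _ x) t) :
    H.toPath ≫ evalAt Y s = SSet.toTop.map k := by
  apply (sSetTopAdj.homEquiv X (SSet.toTop.obj Y)).injective
  rw [Adjunction.homEquiv_naturality_right, toPath, Equiv.apply_symm_apply,
    Adjunction.homEquiv_unit]
  refine Eq.trans ?_ (sSetTopAdj.unit.naturality k)
  ext n x
  apply (TopCat.toSSetObjEquiv _ n).injective
  ext t
  exact hk (n := n.unop.len) x t

/-- A simplicial homotopy induces a homotopy of maps of realizations. -/
theorem homotopic_toTop (H : SimplicialHomotopy f g) :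
    ContinuousMap.Homotopic (SSet.toTop.map f).hom (SSet.toTop.map g).hom := by
  have h₀ := H.toPath_evalAt 0 f H.prismMap_zero
  have h₁ := H.toPath_evalAt 1 g H.prismMap_one
  refine ⟨⟨(ContinuousMap.uncurry H.toPath.hom).comp ContinuousMap.prodSwap, fun z => ?_,
    fun z => ?_⟩⟩
  · exact ConcreteCategory.congr_hom h₀ z
  · exact ConcreteCategory.congr_hom h₁ z

end SimplicialHomotopy

end SSet

/-! ### Functoriality of classifying spaces, and the conclusion. -/

lemma classifyingMap_comp {C D E : Type u} [Bicategory.{u, u} C] [Bicategory.{u, u} D]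
    [Bicategory.{u, u} E] (F : C ⥤ᴸ D) (G : D ⥤ᴸ E) :
    classifyingMap (F.comp G) = (classifyingMap G).comp (classifyingMap F) := by
  have h : geometricNerveMap (F.comp G) = geometricNerveMap F ≫ geometricNerveMap G := by
    ext n z
    exact (lax_comp_assoc z F G).symm
  rw [classifyingMap, h, Functor.map_comp]
  rfl

lemma classifyingMap_id (C : Type u) [Bicategory.{u, u} C] :
    classifyingMap (LaxFunctor.id C) = ContinuousMap.id _ := by
  have h : geometricNerveMap (LaxFunctor.id C) = 𝟙 _ := by
    ext n z
    refine lax_eq_of rfl (fun a => heq_of_eq ?_) (fun a b => heq_of_eq ?_)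
    · exact Category.id_comp _
    · exact Category.id_comp _
  exact (congrArg (fun w => (SSet.toTop.map w).hom) h).trans
    (congrArg TopCat.Hom.hom (SSet.toTop.map_id _))

theorem mainTheorem8 {A B : Type u} [Bicategory.{u, u} A] [Bicategory.{u, u} B] (F : A ⥤ᴸ B) :
    (∃ e : ContinuousMap.HomotopyEquiv (classifyingSpace (HoFiberTotal F)) (classifyingSpace A),
      e.toFun = classifyingMap (HoFiberTotal.proj F).toLax) ∧
    ∃ L : A ⥤ᴸ HoFiberTotal F,
      L.comp (HoFiberTotal.proj F).toLax = LaxFunctor.id A ∧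
      Nonempty (Lax.LaxTrans ((HoFiberTotal.proj F).toLax.comp L)
        (LaxFunctor.id (HoFiberTotal F))) := by
  refine ⟨⟨⟨classifyingMap (HoFiberTotal.proj F).toLax, classifyingMap (HoFiberTotal.sec F),
    ?_, ?_⟩, rfl⟩, HoFiberTotal.sec F, HoFiberTotal.sec_comp_proj F, ⟨HoFiberTotal.counit F⟩⟩
  -- The composite `LQ` is joined to the identity by the oplax transformation.
  · rw [← classifyingMap_comp, ← classifyingMap_id]
    exact (nerveHomotopy (HoFiberTotal.counit F)).homotopic_toTop
  -- The composite `QL` is equal to the identity, so the constant homotopy suffices.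
  · rw [← classifyingMap_comp, HoFiberTotal.sec_comp_proj,
      classifyingMap_id]
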